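/- **Theorem.** For $\tau$ in the upper half-plane and $z \in \mathbb{C}$, put $q = e^{2\pi i \tau}$, $y = e^{2\pi i z}$ and $$\theta_1(\tau,z) = i \sum_{n=-\infty}^{\infty} (-1)^n q^{(n-1/2)^2/2}\, y^{n-1/2}.$$ Let $Y$ be a toric Calabi–Yau 3-fold, i.e. the smooth toric variety of a smooth fan in the lattice $N \cong \mathbb{Z}^3$ such that some linear form $h \colon N \to \mathbb{Z}$ takes the value $1$ on all primitive ray generators; suppose that the fan has at least one three-dimensional cone. Let $V(\Gamma)$ be the set of torus fixed points of $Y$ (equivalently, of three-dimensional cones, or of trivalent vertices of the toric diagram $\Gamma$ of $Y$). Choose a basis of the rank-two lattice $\ker h$, i.e. coordinates $t_1, t_2$ on the 2-torus that preserves the holomorphic volume form. For $v \in V(\Gamma)$ let $w^v_j = a^v_j t_1 + b^v_j t_2$ ($j = 1,2,3$; $a_j^v, b_j^v \in \mathbb{Z}$) be the weights of this 2-torus on the cotangent space at $v$, i.e. the restrictions to $\ker h$ of the basis of $N^\vee$ dual to the generators of the cone of $v$. The equivariant elliptic genus of $Y$ is $$Z_Y(\tau,z;t_1,t_2) = \sum_{v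 \in V(\Gamma)} \prod_{j=1}^{3} \frac{\theta_1(\tau, z + w^v_j)}{\theta_1(\tau, w^v_j)},$$ and its averaged equivariant elliptic genus is $$Z^{av}_Y(\tau,z;t_1,t_2) = \tfrac12\bigl(Z_Y(\tau,z;t_1,t_2) + Z_Y(\tau,z;-t_1,-t_2)\bigr);$$ both are considered for those $(t_1,t_2) \in \mathbb{C}^2$ at which no denominator $\theta_1(\tau,w_j^v)$ vanishes. Then $Z^{av}_Y$ is independent of $t_1$ and $t_2$, and $$Z^{av}_Y(\tau,z;t_1,t_2) = \frac{\chi(Y)}{2}\,\frac{\theta_1(\tau,2z)}{\theta_1(\tau,z)},$$ where $\chi(Y)$ is the topological Euler characteristic of $Y$. At the zeros of $\theta_1(\tau,\cdot)$ the right-hand side has a removable singularity in $z$, and the formula holds there for its continuous extension. -/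

import Mathlib

open Module

noncomputable section

/-- The theta function
`θ₁(τ, z) = i ∑_{n ∈ ℤ} (-1)ⁿ q^{(n - 1/2)²/2} y^{n - 1/2}`, with `q = e^{2πiτ}`, `y = e^{2πiz}`. -/
def theta1 (τ : UpperHalfPlane) (z : ℂ) : ℂ :=
  Complex.I * ∑' n : ℤ, (-1 : ℂ) ^ n
    * Complex.exp (2 * Real.pi * Complex.I * (τ : ℂ) * ((n : ℂ) - 1 / 2) ^ 2 / 2)
    * Complex.exp (2 * Real.pi * Complex.I * z * ((n : ℂ) - 1 / 2))

/-- The convex cone in `ℝ³` generated by a finite set of lattice vectors. -/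
def latticeCone (s : Finset (Fin 3 → ℤ)) : PointedCone ℝ (Fin 3 → ℝ) :=
  PointedCone.hull ℝ ((fun (u : Fin 3 → ℤ) (i : Fin 3) => (u i : ℝ)) '' (s : Set (Fin 3 → ℤ)))

/-- A toric Calabi–Yau threefold, given by its fan in the lattice `N = ℤ³`.
The fan is smooth, so a cone is recorded by the set of its primitive generators.
The canonical bundle of the toric variety is trivial if and only if there is a linear form
`height` on `N` that takes the value `1` on all ray generators. The fan is required to contain
a three-dimensional cone, i.e. the toric diagram has at least one trivalent vertex. -/
structure ToricCY3 where
  /-- the cones of the fan, each one given by its set of primitive generators -/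
  cones : Finset (Finset (Fin 3 → ℤ))
  /-- every face of a cone is a cone of the fan -/
  face_mem : ∀ s ∈ cones, ∀ t, t ⊆ s → t ∈ cones
  /-- smoothness: the generators of a cone are part of a `ℤ`-basis of `N` -/
  smooth : ∀ s ∈ cones, ∃ B : Basis (Fin 3) ℤ (Fin 3 → ℤ), (s : Set (Fin 3 → ℤ)) ⊆ Set.range B
  /-- two cones intersect along the face spanned by their common generators -/
  inter : ∀ s ∈ cones, ∀ t ∈ cones, latticeCone s ⊓ latticeCone t = latticeCone (s ∩ t)
  exists_maximal : ∃ s ∈ cones, s.card = 3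
  height : (Fin 3 → ℤ) →ₗ[ℤ] ℤ
  height_eq_one : ∀ s ∈ cones, ∀ u ∈ s, height u = 1

namespace ToricCY3

variable (Y : ToricCY3)

/-- The primitive generators of the rays of the fan. -/
def rays : Finset (Fin 3 → ℤ) := Y.cones.biUnion id

/-- The total space of the homogeneous coordinates: the points of `ℂ^{rays}` whose vanishing
coordinates all belong to a common cone. -/
def CoxSpace : Type :=
  {x : Y.rays → ℂ // ∃ s ∈ Y.cones, ∀ ρ : Y.rays, x ρ = 0 → (ρ : Fin 3 → ℤ) ∈ s}

instance : TopologicalSpace Y.CoxSpace := by unfold CoxSpace; infer_instance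

/-- The group `G = {g ∈ (ℂˣ)^{rays} | ∏_ρ g_ρ ^ ⟨m, ρ⟩ = 1 for all m ∈ N^∨}`. -/
def coxGroup : Subgroup (Y.rays → ℂˣ) where
  carrier := {g | ∀ m : (Fin 3 → ℤ) →ₗ[ℤ] ℤ, ∏ ρ : Y.rays, g ρ ^ m ρ = 1}
  one_mem' := by intro m; simp
  mul_mem' := by
    intro g h hg hh m
    have h1 := hg m
    have h2 := hh m
    simp only [Pi.mul_apply, mul_zpow, Finset.prod_mul_distrib, h1, h2, mul_one]
  inv_mem' := by
    intro g hg m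
    have h1 := hg m
    simp only [Pi.inv_apply, inv_zpow, Finset.prod_inv_distrib, h1, inv_one]

/-- Two points of the Cox space are identified if they lie in the same orbit of `G`. -/
def coxSetoid : Setoid Y.CoxSpace where
  r x y := ∃ g ∈ Y.coxGroup, ∀ ρ, y.1 ρ = (g ρ : ℂ) * x.1 ρ
  iseqv :=
    { refl := fun x => ⟨1, Y.coxGroup.one_mem, fun ρ => by simp⟩
      symm := by
        rintro x y ⟨g, hg, h⟩
        exact ⟨g⁻¹, Y.coxGroup.inv_mem hg, fun ρ => by simp [h ρ]⟩
      trans := by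
        rintro x y z ⟨g, hg, h⟩ ⟨k, hk, h'⟩
        exact ⟨k * g, Y.coxGroup.mul_mem hk hg, fun ρ => by simp [h ρ, h' ρ, mul_assoc]⟩ }

/-- The toric variety of the fan, with its classical topology, as the quotient of the Cox space by
`G` (homogeneous coordinates; as there is a three-dimensional cone, the rays span `N`). -/
def Space : Type := Quotient Y.coxSetoid

instance : TopologicalSpace Y.Space := by unfold Space; infer_instance

/-- The topological Euler characteristic `χ(Y) = ∑ᵢ (-1)ⁱ dim H_i(Y; ℚ)` (singular homology). -/
def eulerCharacteristic : ℤ :=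
  (((AlgebraicTopology.singularChainComplexFunctor (ModuleCat.{0} ℚ)).obj
    (ModuleCat.of ℚ ℚ)).obj (TopCat.of Y.Space)).homologyEulerChar

/-- The trivalent vertices of the toric diagram: they correspond to the torus fixed points,
that is, to the three-dimensional cones. -/
def vertices : Finset (Finset (Fin 3 → ℤ)) := Y.cones.filter fun s => s.card = 3

theorem range_eq_of_mem_vertices {s : Finset (Fin 3 → ℤ)} (hs : s ∈ Y.vertices) :
    ∃ B : Basis (Fin 3) ℤ (Fin 3 → ℤ), (s : Set (Fin 3 → ℤ)) = Set.range B := by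
  obtain ⟨h1, h2⟩ := Finset.mem_filter.mp hs
  obtain ⟨B, hB⟩ := Y.smooth s h1
  refine ⟨B, Set.eq_of_subset_of_ncard_le hB ?_ (Set.finite_range B)⟩
  rw [Set.ncard_coe_finset, h2, ← Set.image_univ]
  exact (Set.ncard_image_le Set.finite_univ).trans (by simp)

/-- The basis of `N` formed by the generators of a three-dimensional cone. -/
def vertexBasis (v : Y.vertices) : Basis (v : Finset (Fin 3 → ℤ)) ℤ (Fin 3 → ℤ) :=
  Basis.mk (v := fun u : (v : Finset (Fin 3 → ℤ)) => (u : Fin 3 → ℤ))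
    (by
      obtain ⟨B, hB⟩ := Y.range_eq_of_mem_vertices v.2
      have h := B.linearIndependent.linearIndepOn_id
      rw [← hB] at h
      exact h)
    (by
      obtain ⟨B, hB⟩ := Y.range_eq_of_mem_vertices v.2
      have h : Set.range (fun u : (v : Finset (Fin 3 → ℤ)) => (u : Fin 3 → ℤ)) = Set.range B := by
        rw [← hB]; exact Subtype.range_coe
      rw [h, B.span_eq])

/-- The weight `w = a t₁ + b t₂` at the vertex `v` along the edge dual to the facet of `v` opposite
to the generator `u`. The chart of `v` is `ℂ³`, with coordinates the characters in the basis of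
`N^∨` dual to the generators of `v`; the coordinate with index `u` spans a weight space of the
cotangent space at the fixed point. The acting 2-torus is the one that preserves the holomorphic
volume form; its cocharacter lattice is `ker height`, on which `e` chooses coordinates, and
`(a, b)` is the restriction of the dual basis vector of `u` to it. -/
def weight (e : Basis (Fin 2) ℤ (LinearMap.ker Y.height)) (v : Y.vertices)
    (u : (v : Finset (Fin 3 → ℤ))) (t₁ t₂ : ℂ) : ℂ :=
  (((Y.vertexBasis v).coord u (e 0 : Fin 3 → ℤ) : ℤ) : ℂ) * t₁
    + (((Y.vertexBasis v).coord u (e 1 : Fin 3 → ℤ) : ℤ) : ℂ) * t₂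

/-- The equivariant elliptic genus
`Z_Y(τ, z; t₁, t₂) = ∑_v ∏_{j = 1}^{3} θ₁(τ, z + w_j^v) / θ₁(τ, w_j^v)`. -/
def ellipticGenus (e : Basis (Fin 2) ℤ (LinearMap.ker Y.height)) (τ : UpperHalfPlane)
    (z t₁ t₂ : ℂ) : ℂ :=
  ∑ v : Y.vertices, ∏ u : (v : Finset (Fin 3 → ℤ)),
    theta1 τ (z + Y.weight e v u t₁ t₂) / theta1 τ (Y.weight e v u t₁ t₂)

/-- The averaged equivariant elliptic genus. -/
def averagedEllipticGenus (e : Basis (Fin 2) ℤ (LinearMap.ker Y.height)) (τ : UpperHalfPlane)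
    (z t₁ t₂ : ℂ) : ℂ :=
  1 / 2 * (Y.ellipticGenus e τ z t₁ t₂ + Y.ellipticGenus e τ z (-t₁) (-t₂))

/-- The parameters `(t₁, t₂)` at which no denominator of the equivariant elliptic genus vanishes.
(As `θ₁` is odd in `z`, this set is stable under `(t₁, t₂) ↦ (-t₁, -t₂)`.) -/
def IsRegular (e : Basis (Fin 2) ℤ (LinearMap.ker Y.height)) (τ : UpperHalfPlane)
    (t₁ t₂ : ℂ) : Prop :=
  ∀ (v : Y.vertices) (u : (v : Finset (Fin 3 → ℤ))), theta1 τ (Y.weight e v u t₁ t₂) ≠ 0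

end ToricCY3

end

/-! Averaging makes every fixed point contribute the same amount. The form `height` equals 1 on all
generators of a cone, so it is the sum of the dual basis, and on `ker height` the three weights at a
vertex sum to zero. For a + b + c = 0 the three-term identity `Theta.theta1_three_term`, together
with the oddness of θ₁, says that the product at a vertex plus its value at the opposite weights is
θ₁(2z)/θ₁(z). The averaged genus is therefore half the number of vertices times this quotient.
Multiplied by θ₁(z), the formula holds for every z. The averaged genus is continuous in z and the
zeros of θ₁ are isolated, so the formula and the independence of the parameters extend across them.

The three-term identity is a Plücker relation: θ₁(x + y) θ₁(x − y) is a 2 × 2 determinant in the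
even and odd level-two theta series at x and y (`Theta.theta1_add_mul_theta1_sub`).

It remains to identify the number of vertices with χ(Y), defined by singular homology
(`ToricCY3.eulerCharacteristic_eq`). The chart of a cone is a product of lines and punctured lines,
with Euler characteristic 1 if the cone is three-dimensional and 0 otherwise. Adding the cones one
at a time, Mayer–Vietoris yields the count. Additivity of χ over open covers
(`HasChi.mayerVietoris`) rests on small chains, hence on barycentric subdivision, and on the long
exact homology sequence. -/

noncomputable section

/-! ### The theta function -/

namespace Theta

/-- The general term `e^{πi τ p² / 2 + 2πi p x}` of the theta series of level two. -/
def term (τ : UpperHalfPlane) (x : ℂ) (p : ℤ) : ℂ :=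
  Complex.exp (Real.pi * Complex.I * (τ : ℂ) * (p : ℂ) ^ 2 / 2 + 2 * Real.pi * Complex.I * x * p)

/-- The part of the level two theta series with even exponents. -/
def evenPart (τ : UpperHalfPlane) (x : ℂ) : ℂ := ∑' a : ℤ, term τ x (2 * a)

/-- The part of the level two theta series with odd exponents. -/
def oddPart (τ : UpperHalfPlane) (x : ℂ) : ℂ := ∑' a : ℤ, term τ x (2 * a + 1)

theorem im_two_mul_pos (τ : UpperHalfPlane) : 0 < (2 * (τ : ℂ)).im := by
  have := τ.im_pos
  simp only [Complex.mul_im, Complex.re_ofNat, Complex.im_ofNat, zero_mul, add_zero]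
  exact mul_pos two_pos this

/-- For p = 2a the exponent p²/2 is 2a², so this is a Jacobi theta series with modulus 2τ. Odd p
gives the same series with its argument shifted by τ, up to a constant factor. -/
theorem hasSum_evenPart (τ : UpperHalfPlane) (x : ℂ) :
    HasSum (fun a : ℤ => term τ x (2 * a)) (evenPart τ x) := by
  refine Summable.hasSum ?_
  refine ((summable_jacobiTheta₂_term_iff (2 * x) (2 * (τ : ℂ))).2 (im_two_mul_pos τ)).congr
    fun a => ?_
  rw [term, jacobiTheta₂_term]
  congr 1
  push_cast
  ring

theorem hasSum_oddPart (τ : UpperHalfPlane) (x : ℂ) :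
    HasSum (fun a : ℤ => term τ x (2 * a + 1)) (oddPart τ x) := by
  refine Summable.hasSum ?_
  refine (((summable_jacobiTheta₂_term_iff (2 * x + τ) (2 * (τ : ℂ))).2
    (im_two_mul_pos τ)).mul_left (Complex.exp (Real.pi * Complex.I * (τ : ℂ) / 2
      + 2 * Real.pi * Complex.I * x))).congr fun a => ?_
  rw [term, jacobiTheta₂_term, ← Complex.exp_add]
  congr 1
  push_cast
  ring

/-- The general term of the series that defines `θ₁`. -/
def theta1Term (τ : UpperHalfPlane) (z : ℂ) (n : ℤ) : ℂ :=
  (-1 : ℂ) ^ n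
    * Complex.exp (2 * Real.pi * Complex.I * (τ : ℂ) * ((n : ℂ) - 1 / 2) ^ 2 / 2)
    * Complex.exp (2 * Real.pi * Complex.I * z * ((n : ℂ) - 1 / 2))

theorem neg_one_zpow_eq_exp (n : ℤ) : (-1 : ℂ) ^ n = Complex.exp (Real.pi * Complex.I * n) := by
  rw [← Complex.exp_pi_mul_I, ← Complex.exp_int_mul]
  congr 1
  ring

/-- Expanding (n − 1/2)² produces a shift of the argument by −τ/2 and a constant, and the sign (−1)ⁿ
is a shift by 1/2. Convergence and holomorphy of θ₁ are thereby inherited from `jacobiTheta₂`. -/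
theorem theta1Term_eq (τ : UpperHalfPlane) (z : ℂ) (n : ℤ) :
    theta1Term τ z n = Complex.exp (Real.pi * Complex.I * ((τ : ℂ) / 4 - z))
      * jacobiTheta₂_term n (z - τ / 2 + 1 / 2) τ := by
  rw [theta1Term, jacobiTheta₂_term, neg_one_zpow_eq_exp, ← Complex.exp_add, ← Complex.exp_add,
    ← Complex.exp_add]
  congr 1
  ring

theorem summable_theta1Term (τ : UpperHalfPlane) (z : ℂ) : Summable (theta1Term τ z) := by
  refine (((summable_jacobiTheta₂_term_iff (z - τ / 2 + 1 / 2) τ).2 τ.im_pos).mul_left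
    (Complex.exp (Real.pi * Complex.I * ((τ : ℂ) / 4 - z)))).congr fun n => ?_
  rw [theta1Term_eq]

theorem theta1_eq_tsum (τ : UpperHalfPlane) (z : ℂ) :
    theta1 τ z = Complex.I * ∑' n : ℤ, theta1Term τ z n := rfl

theorem theta1_eq_jacobiTheta (τ : UpperHalfPlane) (z : ℂ) :
    theta1 τ z = Complex.I * (Complex.exp (Real.pi * Complex.I * ((τ : ℂ) / 4 - z))
      * jacobiTheta₂ (z - τ / 2 + 1 / 2) τ) := by
  rw [theta1_eq_tsum, jacobiTheta₂, tsum_congr (theta1Term_eq τ z), tsum_mul_left]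

theorem differentiable_theta1 (τ : UpperHalfPlane) : Differentiable ℂ (theta1 τ) := by
  intro z
  have h : theta1 τ = fun z : ℂ =>
      Complex.I * (Complex.exp (Real.pi * Complex.I * ((τ : ℂ) / 4 - z))
      * jacobiTheta₂ (z - τ / 2 + 1 / 2) τ) := funext (theta1_eq_jacobiTheta τ)
  rw [h]
  refine DifferentiableAt.const_mul (DifferentiableAt.mul (by fun_prop) ?_) _
  exact (differentiableAt_jacobiTheta₂_fst _ τ.im_pos).comp z
    (f := fun z : ℂ => z - τ / 2 + 1 / 2) (by fun_prop)

theorem theta1_neg (τ : UpperHalfPlane) (z : ℂ) : theta1 τ (-z) = -theta1 τ z := by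
  -- The reflection n ↦ 1 − n negates n − 1/2 and changes the parity of n, whence the sign.
  rw [theta1_eq_tsum, theta1_eq_tsum, ← (Equiv.subLeft (1 : ℤ)).tsum_eq, ← mul_neg, ← tsum_neg]
  congr 2
  funext n
  simp only [theta1Term, Equiv.subLeft_apply, Int.cast_sub, Int.cast_one]
  rw [zpow_sub₀ (by norm_num), zpow_one]
  have h : (-1 : ℂ) / (-1) ^ n = -(-1) ^ n := by
    rcases Int.even_or_odd n with h | h <;> simp [h.neg_one_zpow]
  rw [h, neg_mul, neg_mul]
  congr 2
  · congr 2; ring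
  · congr 1; ring

/-- The pairs of integers, split according to the parity of their sum, and written as
half sum and half difference. -/
def parityEquiv : (ℤ × ℤ) ⊕ (ℤ × ℤ) ≃ ℤ × ℤ where
  toFun := Sum.elim (fun p => (p.1 + p.2 + 1, p.1 - p.2)) (fun p => (p.1 + p.2 + 1, p.1 - p.2 + 1))
  invFun p := if (p.1 + p.2) % 2 = 1 then Sum.inl ((p.1 + p.2 - 1) / 2, (p.1 - p.2 - 1) / 2)
    else Sum.inr ((p.1 + p.2 - 2) / 2, (p.1 - p.2) / 2)
  left_inv := by
    rintro (⟨a, b⟩ | ⟨a, b⟩)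
    · have h : (a + b + 1 + (a - b)) % 2 = 1 := by omega
      simp only [Sum.elim_inl, h, if_true, Sum.inl.injEq, Prod.mk.injEq]
      omega
    · have h : ¬ (a + b + 1 + (a - b + 1)) % 2 = 1 := by omega
      simp only [Sum.elim_inr, h, if_false, Sum.inr.injEq, Prod.mk.injEq]
      omega
  right_inv := by
    rintro ⟨a, b⟩
    by_cases h : (a + b) % 2 = 1
    · simp only [h, if_true, Sum.elim_inl, Prod.mk.injEq]
      omega
    · simp only [h, if_false, Sum.elim_inr, Prod.mk.injEq]
      omega

theorem theta1Term_mul (τ : UpperHalfPlane) (z w : ℂ) (m n : ℤ) :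
    theta1Term τ z m * theta1Term τ w n = (-1 : ℂ) ^ (m + n)
      * Complex.exp (2 * Real.pi * Complex.I * ((τ : ℂ) * (((m : ℂ) - 1 / 2) ^ 2
        + ((n : ℂ) - 1 / 2) ^ 2) / 2 + z * ((m : ℂ) - 1 / 2) + w * ((n : ℂ) - 1 / 2))) := by
  have h : ∀ s t a b c d : ℂ, s * Complex.exp a * Complex.exp b
      * (t * Complex.exp c * Complex.exp d) = s * t * Complex.exp (a + b + (c + d)) :=
    fun s t a b c d => by simp only [Complex.exp_add]; ring
  rw [theta1Term, theta1Term, zpow_add₀ (by norm_num), h]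
  congr 2
  ring

/-- The half-integers m − 1/2 and n − 1/2 have sum 2a and difference 2b + 1. These multiply x and y,
and the sum of squares of the half-integers is half of (2a)² + (2b + 1)², so the exponential
factors. -/
theorem theta1Term_mul_parity_inl (τ : UpperHalfPlane) (x y : ℂ) (a b : ℤ) :
    theta1Term τ (x + y) (a + b + 1) * theta1Term τ (x - y) (a - b)
      = -(term τ x (2 * a) * term τ y (2 * b + 1)) := by
  rw [theta1Term_mul, Odd.neg_one_zpow ⟨a, by ring⟩, neg_one_mul, term, term, ← Complex.exp_add]
  congr 2
  push_cast
  ring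

theorem theta1Term_mul_parity_inr (τ : UpperHalfPlane) (x y : ℂ) (a b : ℤ) :
    theta1Term τ (x + y) (a + b + 1) * theta1Term τ (x - y) (a - b + 1)
      = term τ x (2 * a + 1) * term τ y (2 * b) := by
  rw [theta1Term_mul, Even.neg_one_zpow ⟨a + 1, by ring⟩, one_mul, term, term, ← Complex.exp_add]
  congr 1
  push_cast
  ring

theorem hasSum_mul_of_hasSum {f g : ℤ → ℂ} {a b : ℂ} (hf : HasSum f a) (hg : HasSum g b) :
    HasSum (fun p : ℤ × ℤ => f p.1 * g p.2) (a * b) :=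
  hf.mul hg (summable_mul_of_summable_norm hf.summable.norm hg.summable.norm)

/-- The addition formula that expresses `θ₁(x + y) θ₁(x - y)` through theta functions of
level two. -/
theorem theta1_add_mul_theta1_sub (τ : UpperHalfPlane) (x y : ℂ) :
    theta1 τ (x + y) * theta1 τ (x - y)
      = evenPart τ x * oddPart τ y - oddPart τ x * evenPart τ y := by
  have hs := hasSum_mul_of_hasSum (summable_theta1Term τ (x + y)).hasSum
    (summable_theta1Term τ (x - y)).hasSum
  have h1 := hasSum_mul_of_hasSum (hasSum_evenPart τ x) (hasSum_oddPart τ y)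
  have h2 := hasSum_mul_of_hasSum (hasSum_oddPart τ x) (hasSum_evenPart τ y)
  have hl : ((fun p : ℤ × ℤ => theta1Term τ (x + y) p.1 * theta1Term τ (x - y) p.2)
      ∘ parityEquiv) ∘ Sum.inl
      = fun p : ℤ × ℤ => -(term τ x (2 * p.1) * term τ y (2 * p.2 + 1)) :=
    funext fun p => theta1Term_mul_parity_inl τ x y p.1 p.2
  have hr : ((fun p : ℤ × ℤ => theta1Term τ (x + y) p.1 * theta1Term τ (x - y) p.2)
      ∘ parityEquiv) ∘ Sum.inr
      = fun p : ℤ × ℤ => term τ x (2 * p.1 + 1) * term τ y (2 * p.2) :=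
    funext fun p => theta1Term_mul_parity_inr τ x y p.1 p.2
  rw [← parityEquiv.hasSum_iff] at hs
  have h3 : HasSum ((fun p : ℤ × ℤ => theta1Term τ (x + y) p.1 * theta1Term τ (x - y) p.2)
      ∘ parityEquiv) (-(evenPart τ x * oddPart τ y) + oddPart τ x * evenPart τ y) :=
    HasSum.sum (by rw [hl]; exact h1.neg) (by rw [hr]; exact h2)
  have h4 := hs.unique h3
  rw [theta1_eq_tsum, theta1_eq_tsum]
  rw [mul_mul_mul_comm, h4, Complex.I_mul_I]
  ring

/-- The three-term identity for `θ₁`, in the form that computes the contribution of a vertex. -/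
theorem theta1_three_term (τ : UpperHalfPlane) (z a b c : ℂ) (h : a + b + c = 0) :
    theta1 τ z * (theta1 τ (z + a) * theta1 τ (z + b) * theta1 τ (z + c)
      - theta1 τ (z - a) * theta1 τ (z - b) * theta1 τ (z - c))
      = theta1 τ (2 * z) * (theta1 τ a * theta1 τ b * theta1 τ c) := by
  obtain rfl : a = -b - c := by linear_combination h
  -- The four points are chosen so that all products occur as [x, y] = θ₁(x + y) θ₁(x − y). By the
  -- addition formula [x, y] is a 2 × 2 determinant, and the claim becomes the Plücker relation
  -- [p,q][r,s] − [p,r][q,s] + [p,s][q,r] = 0.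
  set p : ℂ := z + (-b - c) / 2 with hp
  set q : ℂ := -(-b - c) / 2 with hq
  set r : ℂ := z - (-b - c) / 2 with hr
  set s : ℂ := (b - c) / 2 with hs
  have e1 := theta1_add_mul_theta1_sub τ p q
  have e2 := theta1_add_mul_theta1_sub τ r s
  have e3 := theta1_add_mul_theta1_sub τ p r
  have e4 := theta1_add_mul_theta1_sub τ q s
  have e5 := theta1_add_mul_theta1_sub τ p s
  have e6 := theta1_add_mul_theta1_sub τ q r
  have c1 : p + q = z := by rw [hp, hq]; ring
  have c2 : p - q = z + (-b - c) := by rw [hp, hq]; ring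
  have c3 : r + s = z + b := by rw [hr, hs]; ring
  have c4 : r - s = z + c := by rw [hr, hs]; ring
  have c5 : p + r = 2 * z := by rw [hp, hr]; ring
  have c6 : p - r = -b - c := by rw [hp, hr]; ring
  have c7 : q + s = b := by rw [hq, hs]; ring
  have c8 : q - s = c := by rw [hq, hs]; ring
  have c9 : p + s = z - c := by rw [hp, hs]; ring
  have c10 : p - s = z - b := by rw [hp, hs]; ring
  have c11 : q + r = z - (-b - c) := by rw [hq, hr]; ring
  have c12 : q - r = -z := by rw [hq, hr]; ring
  rw [c1, c2] at e1
  rw [c3, c4] at e2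
  rw [c5, c6] at e3
  rw [c7, c8] at e4
  rw [c9, c10] at e5
  rw [c11, c12, theta1_neg] at e6
  generalize theta1 τ z = t0 at *
  generalize theta1 τ (2 * z) = t1 at *
  generalize theta1 τ (z + (-b - c)) = t2 at *
  generalize theta1 τ (z - (-b - c)) = t3 at *
  generalize theta1 τ (-b - c) = t4 at *
  have k1 : t0 * (t2 * theta1 τ (z + b) * theta1 τ (z + c)) = (t0 * t2)
    * (theta1 τ (z + b) * theta1 τ (z + c)) := by ring
  have k2 : t0 * (t3 * theta1 τ (z - b) * theta1 τ (z - c)) = -(t3 * -t0)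
    * (theta1 τ (z - c) * theta1 τ (z - b)) := by ring
  have k3 : t1 * (t4 * theta1 τ b * theta1 τ c) = (t1 * t4) * (theta1 τ b * theta1 τ c) := by ring
  rw [mul_sub, k1, k2, k3, e1, e2, e3, e4, e5, e6]
  ring

end Theta
end

noncomputable section

/-! ### Chains of ordered simplices and their barycentric subdivision -/

/-- The augmented chains of ordered simplices on a set of vertices `V`: the generators in degree
`k` are the lists of `k` vertices. -/
abbrev OrderedChain (V : Type*) (k : ℕ) : Type _ := (Fin k → V) →₀ ℚ

namespace OrderedChain

variable {V W : Type*}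

/-- The boundary map. -/
def d (k : ℕ) : OrderedChain V (k + 1) →ₗ[ℚ] OrderedChain V k :=
  Finsupp.linearCombination ℚ fun v =>
    ∑ i : Fin (k + 1), (-1 : ℚ) ^ (i : ℕ) • Finsupp.single (v ∘ i.succAbove) 1

/-- The cone over a chain with apex `b`. -/
def cone (b : V) (k : ℕ) : OrderedChain V k →ₗ[ℚ] OrderedChain V (k + 1) :=
  Finsupp.lmapDomain ℚ ℚ (Fin.cons (α := fun _ => V) b)

/-- The map of chains induced by a map of the vertices. -/
def map (f : V → W) (k : ℕ) : OrderedChain V k →ₗ[ℚ] OrderedChain W k :=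
  Finsupp.lmapDomain ℚ ℚ (fun v => f ∘ v)

theorem d_single {k : ℕ} (v : Fin (k + 1) → V) :
    d k (Finsupp.single v 1)
      = ∑ i : Fin (k + 1), (-1 : ℚ) ^ (i : ℕ) • Finsupp.single (v ∘ i.succAbove) 1 := by
  simp [d]

@[simp]
theorem cone_single (b : V) {k : ℕ} (v : Fin k → V) (a : ℚ) :
    cone b k (Finsupp.single v a) = Finsupp.single (Fin.cons (α := fun _ => V) b v) a := by
  simp [cone]

@[simp]
theorem map_single (f : V → W) {k : ℕ} (v : Fin k → V) (a : ℚ) :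
    map f k (Finsupp.single v a) = Finsupp.single (f ∘ v) a := by
  simp [map]

theorem cons_comp_succAbove_succ (b : V) {k : ℕ} (v : Fin (k + 1) → V) (i : Fin (k + 1)) :
    (Fin.cons (α := fun _ => V) b v) ∘ i.succ.succAbove
      = Fin.cons (α := fun _ => V) b (v ∘ i.succAbove) := by
  funext j
  refine Fin.cases ?_ (fun j => ?_) j
  · simp
  · simp

theorem d_cone_zero (b : V) (c : OrderedChain V 0) : d 0 (cone b 0 c) = c := by
  suffices h : d 0 ∘ₗ cone b 0 = LinearMap.id from LinearMap.congr_fun h c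
  refine Finsupp.lhom_ext' fun v => LinearMap.ext_ring ?_
  simp only [LinearMap.comp_apply, Finsupp.lsingle_apply, cone_single, d_single, LinearMap.id_apply]
  rw [Fin.sum_univ_one]
  simp only [Fin.val_zero, pow_zero, one_smul]
  exact congrArg (Finsupp.single · 1) (Subsingleton.elim _ _)

/-- Deleting the apex returns the chain; deleting any other vertex gives the cone over a face, with
the sign shifted by one. Over the empty list only the first case occurs, hence the separate
`d_cone_zero`. -/
theorem d_cone_succ (b : V) {k : ℕ} (c : OrderedChain V (k + 1)) :
    d (k + 1) (cone b (k + 1) c) = c - cone b k (d k c) := by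
  suffices h : d (k + 1) ∘ₗ cone b (k + 1) = LinearMap.id - cone b k ∘ₗ d k from
    LinearMap.congr_fun h c
  refine Finsupp.lhom_ext' fun v => LinearMap.ext_ring ?_
  simp only [LinearMap.comp_apply, Finsupp.lsingle_apply, cone_single, d_single,
    LinearMap.sub_apply, LinearMap.id_apply]
  rw [Fin.sum_univ_succ, map_sum, sub_eq_add_neg, ← Finset.sum_neg_distrib]
  congr 1
  · simp only [Fin.val_zero, pow_zero, one_smul]
    congr 1
  · refine Finset.sum_congr rfl fun i _ => ?_
    rw [cons_comp_succAbove_succ, map_smul, cone_single, Fin.val_succ, pow_succ]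
    simp

/-- Every list is the cone over its tail with its head as apex, so the cone formula reduces the
claim to one degree lower. -/
theorem d_d {k : ℕ} (c : OrderedChain V (k + 2)) : d k (d (k + 1) c) = 0 := by
  induction k with
  | zero =>
    suffices h : d 0 ∘ₗ d 1 = (0 : OrderedChain V 2 →ₗ[ℚ] _) from LinearMap.congr_fun h c
    refine Finsupp.lhom_ext' fun v => LinearMap.ext_ring ?_
    obtain ⟨b, w, rfl⟩ : ∃ b w, v = Fin.cons (α := fun _ => V) b w :=
      ⟨v 0, Fin.tail v, (Fin.cons_self_tail v).symm⟩
    simp only [LinearMap.comp_apply, Finsupp.lsingle_apply, LinearMap.zero_apply]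
    rw [← cone_single, d_cone_succ, map_sub, d_cone_zero, sub_self]
  | succ k ih =>
    suffices h : d (k + 1) ∘ₗ d (k + 2) = (0 : OrderedChain V (k + 3) →ₗ[ℚ] _) from
      LinearMap.congr_fun h c
    refine Finsupp.lhom_ext' fun v => LinearMap.ext_ring ?_
    obtain ⟨b, w, rfl⟩ : ∃ b w, v = Fin.cons (α := fun _ => V) b w :=
      ⟨v 0, Fin.tail v, (Fin.cons_self_tail v).symm⟩
    simp only [LinearMap.comp_apply, Finsupp.lsingle_apply, LinearMap.zero_apply]
    rw [← cone_single, d_cone_succ, map_sub, d_cone_succ, ih, map_zero, sub_zero, sub_self]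

theorem map_d (f : V → W) {k : ℕ} (c : OrderedChain V (k + 1)) :
    map f k (d k c) = d k (map f (k + 1) c) := by
  suffices h : map f k ∘ₗ d k = d k ∘ₗ map f (k + 1) from LinearMap.congr_fun h c
  refine Finsupp.lhom_ext' fun v => LinearMap.ext_ring ?_
  simp only [LinearMap.comp_apply, Finsupp.lsingle_apply, d_single, map_single, map_sum, map_smul]
  rfl

theorem map_cone (f : V → W) (b : V) {k : ℕ} (c : OrderedChain V k) :
    map f (k + 1) (cone b k c) = cone (f b) k (map f k c) := by
  suffices h : map f (k + 1) ∘ₗ cone b k = cone (f b) k ∘ₗ map f k from LinearMap.congr_fun h c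
  refine Finsupp.lhom_ext' fun v => LinearMap.ext_ring ?_
  simp only [LinearMap.comp_apply, Finsupp.lsingle_apply, cone_single, map_single]
  congr 1
  funext j
  refine Fin.cases ?_ (fun j => ?_) j <;> simp

section Subdivision

variable (β : ∀ k : ℕ, (Fin (k + 1) → V) → V) (γ : ∀ k : ℕ, (Fin (k + 1) → W) → W)

/-- The subdivision of chains with respect to a choice of barycenters. -/
def subdiv : ∀ k : ℕ, OrderedChain V k →ₗ[ℚ] OrderedChain V k
  | 0 => LinearMap.id
  | k + 1 => Finsupp.linearCombination ℚ fun v =>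
      cone (β k v) k (subdiv k (d k (Finsupp.single v 1)))

/-- The chain homotopy between the identity and the subdivision. -/
def subdivHomotopy : ∀ k : ℕ, OrderedChain V k →ₗ[ℚ] OrderedChain V (k + 1)
  | 0 => 0
  | k + 1 => Finsupp.linearCombination ℚ fun v =>
      cone (β k v) (k + 1) (Finsupp.single v 1 - subdivHomotopy k (d k (Finsupp.single v 1)))

theorem subdiv_single {k : ℕ} (v : Fin (k + 1) → V) :
    subdiv β (k + 1) (Finsupp.single v 1)
      = cone (β k v) k (subdiv β k (d k (Finsupp.single v 1))) := by
  simp [subdiv]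

theorem subdivHomotopy_single {k : ℕ} (v : Fin (k + 1) → V) :
    subdivHomotopy β (k + 1) (Finsupp.single v 1) = cone (β k v) (k + 1)
      (Finsupp.single v 1 - subdivHomotopy β k (d k (Finsupp.single v 1))) := by
  simp [subdivHomotopy]

theorem d_subdiv {k : ℕ} (c : OrderedChain V (k + 1)) :
    d k (subdiv β (k + 1) c) = subdiv β k (d k c) := by
  suffices h : d k ∘ₗ subdiv β (k + 1) = subdiv β k ∘ₗ d k from LinearMap.congr_fun h c
  induction k with
  | zero =>
    refine Finsupp.lhom_ext' fun v => LinearMap.ext_ring ?_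
    simp only [LinearMap.comp_apply, Finsupp.lsingle_apply, subdiv_single, d_cone_zero]
  | succ k ih =>
    refine Finsupp.lhom_ext' fun v => LinearMap.ext_ring ?_
    have ih' : ∀ c, d k (subdiv β (k + 1) c) = subdiv β k (d k c) := LinearMap.congr_fun (ih (d _ c))
    simp only [LinearMap.comp_apply, Finsupp.lsingle_apply]
    rw [subdiv_single, d_cone_succ, ih', d_d, map_zero, map_zero, sub_zero]

theorem d_subdivHomotopy_zero (c : OrderedChain V 0) :
    d 0 (subdivHomotopy β 0 c) = c - subdiv β 0 c := by
  simp [subdivHomotopy, subdiv]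

theorem d_subdivHomotopy_succ {k : ℕ} (c : OrderedChain V (k + 1)) :
    d (k + 1) (subdivHomotopy β (k + 1) c)
      = c - subdiv β (k + 1) c - subdivHomotopy β k (d k c) := by
  suffices h : d (k + 1) ∘ₗ subdivHomotopy β (k + 1)
      = LinearMap.id - subdiv β (k + 1) - subdivHomotopy β k ∘ₗ d k from LinearMap.congr_fun h c
  -- On a boundary the correction term of the homotopy formula dies because d² = 0. This is what the
  -- cone formula needs, since d(v − H(dv)) is then the subdivision of dv.
  have key : ∀ v : Fin (k + 1) → V, d k (subdivHomotopy β k (d k (Finsupp.single v 1)))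
      = d k (Finsupp.single v 1) - subdiv β k (d k (Finsupp.single v 1)) := by
    clear c
    induction k with
    | zero => intro v; exact d_subdivHomotopy_zero β _
    | succ k ih =>
      intro v
      have h : d (k + 1) ∘ₗ subdivHomotopy β (k + 1)
          = LinearMap.id - subdiv β (k + 1) - subdivHomotopy β k ∘ₗ d k := by
        refine Finsupp.lhom_ext' fun w => LinearMap.ext_ring ?_
        simp only [LinearMap.comp_apply, Finsupp.lsingle_apply, LinearMap.sub_apply,
          LinearMap.id_apply]
        rw [subdivHomotopy_single, d_cone_succ, map_sub, ih, sub_sub_cancel, subdiv_single]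
        abel
      have := LinearMap.congr_fun h (d (k + 1) (Finsupp.single v 1))
      simpa [d_d] using this
  refine Finsupp.lhom_ext' fun w => LinearMap.ext_ring ?_
  simp only [LinearMap.comp_apply, Finsupp.lsingle_apply, LinearMap.sub_apply, LinearMap.id_apply]
  rw [subdivHomotopy_single, d_cone_succ, map_sub, key, sub_sub_cancel, subdiv_single]
  abel

variable {β γ}

/-- Used for affine maps between simplices, which preserve barycenters; it is the source of the
naturality of subdivision for singular chains. -/
theorem map_subdiv {f : V → W} (hf : ∀ k v, f (β k v) = γ k (f ∘ v)) {k : ℕ}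
    (c : OrderedChain V k) : map f k (subdiv β k c) = subdiv γ k (map f k c) := by
  induction k with
  | zero => rfl
  | succ k ih =>
    suffices h : map f (k + 1) ∘ₗ subdiv β (k + 1) = subdiv γ (k + 1) ∘ₗ map f (k + 1) from
      LinearMap.congr_fun h c
    refine Finsupp.lhom_ext' fun v => LinearMap.ext_ring ?_
    simp only [LinearMap.comp_apply, Finsupp.lsingle_apply, map_single]
    rw [subdiv_single, subdiv_single, map_cone, ih, map_d, map_single, hf]

theorem map_subdivHomotopy {f : V → W} (hf : ∀ k v, f (β k v) = γ k (f ∘ v)) {k : ℕ}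
    (c : OrderedChain V k) :
    map f (k + 1) (subdivHomotopy β k c) = subdivHomotopy γ k (map f k c) := by
  induction k with
  | zero => simp [subdivHomotopy]
  | succ k ih =>
    suffices h : map f (k + 2) ∘ₗ subdivHomotopy β (k + 1)
        = subdivHomotopy γ (k + 1) ∘ₗ map f (k + 1) from LinearMap.congr_fun h c
    refine Finsupp.lhom_ext' fun v => LinearMap.ext_ring ?_
    simp only [LinearMap.comp_apply, Finsupp.lsingle_apply, map_single]
    rw [subdivHomotopy_single, subdivHomotopy_single, map_cone, map_sub, ih, map_d, map_single, hf]

end Subdivision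

end OrderedChain
end

noncomputable section

/-! ### Affine simplices and the mesh of the barycentric subdivision -/

namespace AffineSimplex

variable {ι κ μ : Type*} [Fintype ι] [Fintype κ] [Fintype μ]

/-- The affine simplex with given vertices. -/
def affine (v : κ → stdSimplex ℝ ι) : C(stdSimplex ℝ κ, stdSimplex ℝ ι) where
  toFun t := ⟨fun i => ∑ j, t j * v j i,
    fun i => Finset.sum_nonneg fun j _ => mul_nonneg (stdSimplex.zero_le t j) (stdSimplex.zero_le (v j) i), by
      rw [Finset.sum_comm]
      simp only [← Finset.mul_sum, stdSimplex.sum_eq_one, mul_one]⟩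
  continuous_toFun := by
    refine Continuous.subtype_mk (continuous_pi fun i => continuous_finsetSum _ fun j _ => ?_) _
    exact ((continuous_apply j).comp continuous_subtype_val).mul continuous_const

theorem affine_apply (v : κ → stdSimplex ℝ ι) (t : stdSimplex ℝ κ) (i : ι) :
    affine v t i = ∑ j, t j * v j i := rfl

theorem affine_affine (v : κ → stdSimplex ℝ ι) (w : μ → stdSimplex ℝ κ) (t : stdSimplex ℝ μ) :
    affine v (affine w t) = affine (affine v ∘ w) t := by
  ext i
  simp only [affine_apply, Function.comp_apply, Finset.sum_mul, Finset.mul_sum]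
  rw [Finset.sum_comm]
  simp only [mul_assoc]

theorem affine_vertex [DecidableEq ι] :
    affine (fun i : ι => (stdSimplex.vertex i : stdSimplex ℝ ι)) = ContinuousMap.id _ := by
  ext t i
  simp [affine_apply, Pi.single_apply]

theorem affine_map [DecidableEq κ] (v : κ → stdSimplex ℝ ι) (f : μ → κ) (t : stdSimplex ℝ μ) :
    affine v (stdSimplex.map f t) = affine (v ∘ f) t := by
  ext i
  simp only [affine_apply, stdSimplex.map_coe, FunOnFinite.linearMap_apply_apply, Finset.sum_mul,
    Function.comp_apply]
  rw [← Finset.sum_fiberwise Finset.univ f]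
  refine Finset.sum_congr rfl fun j _ => ?_
  refine Finset.sum_congr ?_ fun a ha => ?_
  · ext; simp
  · simp only [Finset.mem_filter] at ha
    rw [ha.2]

/-- The barycenter of a list of points. -/
def bary (k : ℕ) (v : Fin (k + 1) → stdSimplex ℝ ι) : stdSimplex ℝ ι :=
  affine v stdSimplex.barycenter

theorem affine_bary (v : κ → stdSimplex ℝ ι) (k : ℕ) (w : Fin (k + 1) → stdSimplex ℝ κ) :
    affine v (bary k w) = bary k (affine v ∘ w) :=
  affine_affine v w _

/-- Convexity of the distance to p: the weights sum to 1, so in each coordinate the difference is a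
convex combination of the differences to the vertices. -/
theorem dist_affine_le {p : stdSimplex ℝ ι} {v : κ → stdSimplex ℝ ι} {r : κ → ℝ}
    (h : ∀ j, dist p (v j) ≤ r j) (t : stdSimplex ℝ κ) :
    dist p (affine v t) ≤ ∑ j, t j * r j := by
  have hr : ∀ j, 0 ≤ r j := fun j => dist_nonneg.trans (h j)
  refine (dist_pi_le_iff (Finset.sum_nonneg fun j _ => mul_nonneg (stdSimplex.zero_le t j) (hr j))).2
    fun i => ?_
  change |p i - affine v t i| ≤ _
  have : p i - affine v t i = ∑ j, t j * (p i - v j i) := by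
    simp only [affine_apply, mul_sub, Finset.sum_sub_distrib, ← Finset.sum_mul,
      stdSimplex.sum_eq_one, one_mul]
  rw [this]
  refine (Finset.abs_sum_le_sum_abs _ _).trans (Finset.sum_le_sum fun j _ => ?_)
  rw [abs_mul, abs_of_nonneg (stdSimplex.zero_le t j)]
  refine mul_le_mul_of_nonneg_left ?_ (stdSimplex.zero_le t j)
  exact (dist_le_pi_dist (p : ι → ℝ) (v j : ι → ℝ) i).trans (h j)

theorem dist_affine_le_const {p : stdSimplex ℝ ι} {v : κ → stdSimplex ℝ ι} {r : ℝ}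
    (h : ∀ j, dist p (v j) ≤ r) (t : stdSimplex ℝ κ) : dist p (affine v t) ≤ r := by
  refine (dist_affine_le h t).trans_eq ?_
  rw [← Finset.sum_mul, stdSimplex.sum_eq_one, one_mul]

/-- The point `v a` is itself one of the k + 1 equally weighted points and contributes 0; the other
k contribute at most D each. -/
theorem dist_bary_le {k : ℕ} {v : Fin (k + 1) → stdSimplex ℝ ι} {D : ℝ}
    (h : ∀ i j, dist (v i) (v j) ≤ D) (a : Fin (k + 1)) :
    dist (v a) (bary k v) ≤ (k : ℝ) / (k + 1) * D := by
  have h' : ∀ j, dist (v a) (v j) ≤ if j = a then 0 else D := fun j => by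
    by_cases hj : j = a
    · simp [hj]
    · simpa [hj] using h a j
  refine (dist_affine_le h' _).trans_eq ?_
  change ∑ j, ((Fintype.card (Fin (k + 1)) : ℝ))⁻¹ * _ = _
  rw [← Finset.mul_sum, Finset.sum_ite, Finset.sum_const_zero, zero_add, Finset.sum_const,
    Finset.filter_ne' Finset.univ a, Finset.card_erase_of_mem (Finset.mem_univ a)]
  simp
  field_simp

open OrderedChain

/-- `w` lies in every closed ball that contains `v`. -/
def InHull {k l : ℕ} (v : Fin k → stdSimplex ℝ ι) (w : Fin l → stdSimplex ℝ ι) : Prop :=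
  ∀ p r, (∀ a, dist p (v a) ≤ r) → ∀ i, dist p (w i) ≤ r

/-- The chains of simplices whose edges are not longer than `D`. -/
def meshLE (D : ℝ) (k : ℕ) : Submodule ℚ (OrderedChain (stdSimplex ℝ ι) k) :=
  Submodule.span ℚ ((fun w => Finsupp.single w 1) '' {w | ∀ i j, dist (w i) (w j) ≤ D})

/-- New edges either lie in the subdivision of a face, covered by induction, or join the barycenter
to such a simplex. The hull condition is carried along for the latter: a ball around the barycenter
that contains the vertices of `v` contains the new ones too. -/
theorem subdiv_single_mem {k : ℕ} {v : Fin (k + 1) → stdSimplex ℝ ι} {D : ℝ}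
    (h : ∀ i j, dist (v i) (v j) ≤ D) :
    subdiv bary (k + 1) (Finsupp.single v 1) ∈ Submodule.span ℚ ((fun w => Finsupp.single w 1) ''
      {w : Fin (k + 1) → stdSimplex ℝ ι | InHull v w ∧
        ∀ i j, dist (w i) (w j) ≤ (k : ℝ) / (k + 1) * D}) := by
  have hD : 0 ≤ D := dist_nonneg.trans (h 0 0)
  induction k with
  | zero =>
    have hv : bary 0 v = v 0 := by
      have h1 : ((0 : ℕ) : ℝ) / ((0 : ℕ) + 1) * D = 0 := by simp
      exact (dist_le_zero.1 ((dist_bary_le h 0).trans_eq h1)).symm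
    refine Submodule.subset_span ⟨v, ⟨fun p r hp => hp, fun i j => ?_⟩, ?_⟩
    · rw [Subsingleton.elim (α := Fin 1) i j]; simp
    · have hd : d 0 (Finsupp.single v 1) = Finsupp.single Fin.elim0 1 := by
        rw [d_single, Fin.sum_univ_one, Fin.val_zero, pow_zero, one_smul]
        exact congrArg (Finsupp.single · 1) (Subsingleton.elim _ _)
      dsimp only
      rw [subdiv_single, hd, subdiv, LinearMap.id_apply, cone_single, hv]
      congr 1
      funext i
      rw [Subsingleton.elim (α := Fin 1) i 0]
      rfl
  | succ k ih =>
    rw [subdiv_single]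
    -- The contraction factor grows with the dimension, so the bound for faces is the stronger one.
    have hfac : (k : ℝ) / (k + 1) * D ≤ ((k + 1 : ℕ) : ℝ) / ((k + 1 : ℕ) + 1) * D := by
      refine mul_le_mul_of_nonneg_right ?_ hD
      rw [div_le_div_iff₀ (by positivity) (by positivity)]
      push_cast
      nlinarith
    have hb : InHull v (fun _ : Fin 1 => bary (k + 1) v) := fun p r hp _ => dist_affine_le_const hp _
    have hbd : ∀ a, dist (bary (k + 1) v) (v a) ≤ ((k + 1 : ℕ) : ℝ) / ((k + 1 : ℕ) + 1) * D :=
      fun a => (dist_comm _ _).trans_le (dist_bary_le h a)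
    suffices hface : ∀ c ∈ Submodule.span ℚ ((fun w => Finsupp.single w (1 : ℚ)) ''
        {w : Fin (k + 1) → stdSimplex ℝ ι | InHull v w ∧ ∀ i j, dist (w i) (w j) ≤
          (k : ℝ) / (k + 1) * D}), cone (bary (k + 1) v) (k + 1) c ∈ Submodule.span ℚ
        ((fun w => Finsupp.single w (1 : ℚ)) '' {w : Fin (k + 2) → stdSimplex ℝ ι | InHull v w ∧
          ∀ i j, dist (w i) (w j) ≤ ((k + 1 : ℕ) : ℝ) / ((k + 1 : ℕ) + 1) * D}) by
      refine hface _ ?_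
      rw [d_single, map_sum]
      refine Submodule.sum_mem _ fun i _ => ?_
      rw [map_smul]
      refine Submodule.smul_mem _ _ ?_
      refine Submodule.span_mono (Set.image_mono ?_)
        (ih (v := v ∘ i.succAbove) fun a b => h _ _)
      rintro w ⟨hw1, hw2⟩
      exact ⟨fun p r hp => hw1 p r fun a => hp _, hw2⟩
    intro c hc
    refine Submodule.span_induction ?_ ?_ ?_ ?_ hc
    · rintro _ ⟨w, ⟨hw1, hw2⟩, rfl⟩
      dsimp only
      rw [cone_single]
      refine Submodule.subset_span ⟨_, ⟨fun p r hp => ?_, ?_⟩, rfl⟩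
      · refine Fin.cases ?_ fun i => ?_
        · exact hb p r hp 0
        · exact hw1 p r hp i
      · have h0 : 0 ≤ ((k + 1 : ℕ) : ℝ) / ((k + 1 : ℕ) + 1) * D := by positivity
        refine Fin.cases (Fin.cases ?_ fun j => ?_) fun i => Fin.cases ?_ fun j => ?_
        · simpa using h0
        · exact hw1 _ _ hbd j
        · exact (dist_comm _ _).trans_le (hw1 _ _ hbd i)
        · exact (hw2 i j).trans hfac
    · rw [map_zero]; exact Submodule.zero_mem _
    · intro x y _ _ hx hy; rw [map_add]; exact Submodule.add_mem _ hx hy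
    · intro a x _ hx; rw [map_smul]; exact Submodule.smul_mem _ _ hx

theorem subdiv_mem_meshLE {k : ℕ} {D : ℝ} {c : OrderedChain (stdSimplex ℝ ι) (k + 1)}
    (hc : c ∈ meshLE D (k + 1)) :
    subdiv bary (k + 1) c ∈ meshLE ((k : ℝ) / (k + 1) * D) (k + 1) := by
  refine Submodule.span_induction ?_ ?_ ?_ ?_ hc
  · rintro _ ⟨w, hw, rfl⟩
    exact Submodule.span_mono (Set.image_mono fun w hw => hw.2) (subdiv_single_mem hw)
  · rw [map_zero]; exact Submodule.zero_mem _
  · intro x y _ _ hx hy; rw [map_add]; exact Submodule.add_mem _ hx hy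
  · intro a x _ hx; rw [map_smul]; exact Submodule.smul_mem _ _ hx

theorem exists_subdiv_iterate_mem_meshLE {k : ℕ} (v : Fin (k + 1) → stdSimplex ℝ ι) {δ : ℝ}
    (hδ : 0 < δ) : ∃ m : ℕ, ∀ n, m ≤ n →
      (subdiv bary (k + 1))^[n] (Finsupp.single v 1) ∈ meshLE δ (k + 1) := by
  obtain ⟨D, hD⟩ : ∃ D, ∀ i j, dist (v i) (v j) ≤ D := by
    obtain ⟨D, hD⟩ := (Set.finite_range fun p : Fin (k + 1) × Fin (k + 1) =>
      dist (v p.1) (v p.2)).bddAbove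
    exact ⟨D, fun i j => hD ⟨(i, j), rfl⟩⟩
  have hiter : ∀ n : ℕ, (subdiv bary (k + 1))^[n] (Finsupp.single v 1)
      ∈ meshLE (((k : ℝ) / (k + 1)) ^ n * D) (k + 1) := by
    intro n
    induction n with
    | zero => exact Submodule.subset_span ⟨v, by simpa using hD, rfl⟩
    | succ n ih =>
      rw [Function.iterate_succ_apply', pow_succ', mul_assoc]
      exact subdiv_mem_meshLE ih
  have hlim : Filter.Tendsto (fun n : ℕ => ((k : ℝ) / (k + 1)) ^ n * D) Filter.atTop
      (nhds (0 * D)) :=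
    (tendsto_pow_atTop_nhds_zero_of_lt_one (by positivity)
      ((div_lt_one (by positivity)).2 (by linarith))).mul_const D
  rw [zero_mul] at hlim
  obtain ⟨m, hm⟩ := Filter.eventually_atTop.1 (hlim.eventually (gt_mem_nhds hδ))
  refine ⟨m, fun n hn => Submodule.span_mono (Set.image_mono fun w hw i j => ?_) (hiter n)⟩
  exact (hw i j).trans (hm n hn).le

end AffineSimplex
end

noncomputable section

/-! ### Singular chains with rational coefficients -/

open CategoryTheory Limits

/-- The singular chain complex with rational coefficients. -/
abbrev singularChains (X : Type) [TopologicalSpace X] : ChainComplex (ModuleCat.{0} ℚ) ℕ :=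
  ((AlgebraicTopology.singularChainComplexFunctor (ModuleCat.{0} ℚ)).obj
    (ModuleCat.of ℚ ℚ)).obj (TopCat.of X)

/-- The map of singular chain complexes induced by a continuous map. -/
abbrev singularChainsMap {X Y : Type} [TopologicalSpace X] [TopologicalSpace Y] (f : C(X, Y)) :
    singularChains X ⟶ singularChains Y :=
  ((AlgebraicTopology.singularChainComplexFunctor (ModuleCat.{0} ℚ)).obj
    (ModuleCat.of ℚ ℚ)).map (TopCat.ofHom f)

namespace SingularChain

open Simplicial

variable {X Y : Type} [TopologicalSpace X] [TopologicalSpace Y]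

/-- The simplices of the singular simplicial set are the continuous maps. -/
def simplexEquiv (X : Type) [TopologicalSpace X] (k : ℕ) :
    (TopCat.toSSet.obj (TopCat.of X)) _⦋k⦌ ≃ C(stdSimplex ℝ (Fin (k + 1)), X) :=
  TopCat.toSSetObjEquiv (TopCat.of X) (Opposite.op ⦋k⦌)

/-- The singular chain given by one simplex. -/
def of {k : ℕ} (σ : C(stdSimplex ℝ (Fin (k + 1)), X)) : (singularChains X).X k :=
  ((TopCat.toSSet.obj (TopCat.of X)).ιChainComplex (R := ModuleCat.of ℚ ℚ)
    ((simplexEquiv X k).symm σ)).hom (1 : ℚ)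

/-- The inclusion of the face opposite to a vertex. -/
def face {k : ℕ} (i : Fin (k + 2)) :
    C(stdSimplex ℝ (Fin (k + 1)), stdSimplex ℝ (Fin (k + 2))) :=
  ⟨stdSimplex.map i.succAbove, stdSimplex.continuous_map _⟩

theorem simplexEquiv_δ {k : ℕ} (x : (TopCat.toSSet.obj (TopCat.of X)) _⦋k + 1⦌) (i : Fin (k + 2)) :
    simplexEquiv X k ((TopCat.toSSet.obj (TopCat.of X)).δ i x)
      = (simplexEquiv X (k + 1) x).comp (face i) := rfl

theorem hom_neg_one_pow_smul {M : ModuleCat.{0} ℚ} (φ : ModuleCat.of ℚ ℚ ⟶ M) (n : ℕ) :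
    ModuleCat.Hom.hom ((-1 : ℤ) ^ n • φ) (1 : ℚ) = (-1 : ℚ) ^ n • φ.hom (1 : ℚ) := by
  rcases neg_one_pow_eq_or ℤ n with h | h
  · have h' : (-1 : ℚ) ^ n = 1 := by exact_mod_cast h
    rw [h, h', one_smul, one_smul]
  · have h' : (-1 : ℚ) ^ n = -1 := by exact_mod_cast h
    rw [h, h', neg_smul, neg_smul, one_smul, one_smul]
    rfl

theorem d_of {k : ℕ} (σ : C(stdSimplex ℝ (Fin (k + 2)), X)) :
    ((singularChains X).d (k + 1) k).hom (of σ)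
      = ∑ i : Fin (k + 2), (-1 : ℚ) ^ (i : ℕ) • of (σ.comp (face i)) := by
  have h := congrArg (fun φ => ModuleCat.Hom.hom φ (1 : ℚ))
    ((TopCat.toSSet.obj (TopCat.of X)).ιChainComplex_d (ModuleCat.of ℚ ℚ)
      ((simplexEquiv X (k + 1)).symm σ))
  refine h.trans ?_
  rw [ModuleCat.hom_sum, LinearMap.sum_apply]
  refine Finset.sum_congr rfl fun i _ => ?_
  refine (hom_neg_one_pow_smul _ _).trans ?_
  have e : (TopCat.toSSet.obj (TopCat.of X)).δ i ((simplexEquiv X (k + 1)).symm σ)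
      = (simplexEquiv X k).symm (σ.comp (face i)) := by
    rw [Equiv.eq_symm_apply, simplexEquiv_δ, Equiv.apply_symm_apply]
  rw [of, ← e]
  rfl

theorem map_of {k : ℕ} (f : C(X, Y)) (σ : C(stdSimplex ℝ (Fin (k + 1)), X)) :
    ((singularChainsMap f).f k).hom (of σ) = of (f.comp σ) := by
  have h := congrArg (fun φ => ModuleCat.Hom.hom φ (1 : ℚ))
    (SSet.ι_chainComplexMap_f _ _ (TopCat.toSSet.map (TopCat.ofHom f)) (ModuleCat.of ℚ ℚ)
      ((simplexEquiv X k).symm σ))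
  refine h.trans ?_
  rw [of]
  congr 2

/-- The chain module is a coproduct of copies of ℚ indexed by the simplices, and a linear map on
each copy is determined by its value at 1. -/
theorem hom_ext {k : ℕ} {M : Type} [AddCommGroup M] [Module ℚ M]
    {f g : (singularChains X).X k →ₗ[ℚ] M} (h : ∀ σ, f (of σ) = g (of σ)) : f = g := by
  suffices h : ModuleCat.ofHom f = ModuleCat.ofHom g from congrArg ModuleCat.Hom.hom h
  refine SSet.chainComplex_hom_ext fun x => ?_
  ext
  have := h (simplexEquiv X k x)
  rw [of, Equiv.symm_apply_apply] at this
  exact this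

/-- The coefficients of a chain. -/
def coeffs (X : Type) [TopologicalSpace X] (k : ℕ) :
    (singularChains X).X k →ₗ[ℚ] (C(stdSimplex ℝ (Fin (k + 1)), X) →₀ ℚ) :=
  ModuleCat.Hom.hom (((TopCat.toSSet.obj (TopCat.of X)).isColimitChainComplexXCofan
      (ModuleCat.of ℚ ℚ) k).desc (Cofan.mk (ModuleCat.of ℚ (C(stdSimplex ℝ (Fin (k + 1)), X) →₀ ℚ))
        fun x => ModuleCat.ofHom (Finsupp.lsingle (simplexEquiv X k x))))

theorem coeffs_of {k : ℕ} (σ : C(stdSimplex ℝ (Fin (k + 1)), X)) :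
    coeffs X k (of σ) = Finsupp.single σ 1 := by
  have h := congrArg (fun φ => ModuleCat.Hom.hom φ (1 : ℚ))
    (((TopCat.toSSet.obj (TopCat.of X)).isColimitChainComplexXCofan
      (ModuleCat.of ℚ ℚ) k).fac (Cofan.mk (ModuleCat.of ℚ (C(stdSimplex ℝ (Fin (k + 1)), X) →₀ ℚ))
        fun x => ModuleCat.ofHom (Finsupp.lsingle (simplexEquiv X k x)))
        ⟨(simplexEquiv X k).symm σ⟩)
  refine h.trans ?_
  simp

/-- The simplices form a basis of the singular chains. -/
def basis (X : Type) [TopologicalSpace X] (k : ℕ) :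
    Basis C(stdSimplex ℝ (Fin (k + 1)), X) ℚ ((singularChains X).X k) where
  repr := LinearEquiv.ofLinearMap (coeffs X k) (Finsupp.linearCombination ℚ of)
    (Finsupp.lhom_ext' fun σ => LinearMap.ext_ring (by simp [coeffs_of]))
    (hom_ext fun σ => by simp [coeffs_of])

@[simp]
theorem basis_apply {k : ℕ} (σ : C(stdSimplex ℝ (Fin (k + 1)), X)) : basis X k σ = of σ := by
  simp [basis]

end SingularChain
end

/-! ### Barycentric subdivision of singular chains. -/

noncomputable section

namespace SingularChain

open OrderedChain AffineSimplex

variable {X Y : Type} [TopologicalSpace X] [TopologicalSpace Y]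

theorem affine_comp_face {ι : Type*} [Fintype ι] {k : ℕ} (v : Fin (k + 2) → stdSimplex ℝ ι)
    (i : Fin (k + 2)) : (affine v).comp (face i) = affine (v ∘ i.succAbove) :=
  ContinuousMap.ext fun t => affine_map v i.succAbove t

theorem affine_apply_vertex {ι κ : Type*} [Fintype ι] [Fintype κ] [DecidableEq κ]
    (v : κ → stdSimplex ℝ ι) (j : κ) : affine v (stdSimplex.vertex j) = v j := by
  ext i
  simp [affine_apply, Pi.single_apply]

/-- The singular chain obtained by restricting a simplex to the affine simplices of an ordered
chain. -/
def realize {N : ℕ} (σ : C(stdSimplex ℝ (Fin (N + 1)), X)) (k : ℕ) :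
    OrderedChain (stdSimplex ℝ (Fin (N + 1))) (k + 1) →ₗ[ℚ] (singularChains X).X k :=
  Finsupp.linearCombination ℚ fun v => of (σ.comp (affine v))

theorem realize_single {N k : ℕ} (σ : C(stdSimplex ℝ (Fin (N + 1)), X))
    (v : Fin (k + 1) → stdSimplex ℝ (Fin (N + 1))) :
    realize σ k (Finsupp.single v 1) = of (σ.comp (affine v)) := by
  simp [realize]

/-- The ordered list of the vertices of the standard simplex, as a chain. -/
def fundamental (N : ℕ) : OrderedChain (stdSimplex ℝ (Fin (N + 1))) (N + 1) :=
  Finsupp.single (fun i => stdSimplex.vertex i) 1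

theorem realize_fundamental {N : ℕ} (σ : C(stdSimplex ℝ (Fin (N + 1)), X)) :
    realize σ N (fundamental N) = of σ := by
  rw [fundamental, realize_single, affine_vertex, ContinuousMap.comp_id]

theorem d_realize {N k : ℕ} (σ : C(stdSimplex ℝ (Fin (N + 1)), X))
    (c : OrderedChain (stdSimplex ℝ (Fin (N + 1))) (k + 2)) :
    ((singularChains X).d (k + 1) k).hom (realize σ (k + 1) c)
      = realize σ k (OrderedChain.d (k + 1) c) := by
  suffices h : ((singularChains X).d (k + 1) k).hom ∘ₗ realize σ (k + 1)
      = realize σ k ∘ₗ OrderedChain.d (k + 1) from LinearMap.congr_fun h c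
  refine Finsupp.lhom_ext' fun v => LinearMap.ext_ring ?_
  simp only [LinearMap.comp_apply, Finsupp.lsingle_apply]
  rw [realize_single, d_of, d_single, map_sum]
  refine Finset.sum_congr rfl fun i _ => ?_
  rw [map_smul, realize_single, ContinuousMap.comp_assoc, affine_comp_face]

theorem realize_comp_affine {N M k : ℕ} (σ : C(stdSimplex ℝ (Fin (N + 1)), X))
    (v : Fin (M + 1) → stdSimplex ℝ (Fin (N + 1)))
    (c : OrderedChain (stdSimplex ℝ (Fin (M + 1))) (k + 1)) :
    realize (σ.comp (affine v)) k c = realize σ k (OrderedChain.map (affine v) (k + 1) c) := by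
  suffices h : realize (σ.comp (affine v)) k
      = realize σ k ∘ₗ OrderedChain.map (affine v) (k + 1) from LinearMap.congr_fun h c
  refine Finsupp.lhom_ext' fun w => LinearMap.ext_ring ?_
  simp only [LinearMap.comp_apply, Finsupp.lsingle_apply]
  rw [map_single, realize_single, realize_single, ContinuousMap.comp_assoc]
  congr 2
  exact ContinuousMap.ext fun t => affine_affine v w t

theorem map_affine_fundamental {N k : ℕ} (v : Fin (k + 1) → stdSimplex ℝ (Fin (N + 1))) :
    OrderedChain.map (affine v) (k + 1) (fundamental k) = Finsupp.single v 1 := by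
  rw [fundamental, map_single]
  congr 1
  exact funext fun j => affine_apply_vertex v j

/-- The barycentric subdivision of singular chains. -/
def sd (X : Type) [TopologicalSpace X] (k : ℕ) : (singularChains X).X k →ₗ[ℚ] (singularChains X).X k :=
  (basis X k).constr ℚ fun σ => realize σ k (subdiv bary (k + 1) (fundamental k))

/-- The chain homotopy between the identity and the barycentric subdivision. -/
def sdHomotopy (X : Type) [TopologicalSpace X] (k : ℕ) :
    (singularChains X).X k →ₗ[ℚ] (singularChains X).X (k + 1) :=
  (basis X k).constr ℚ fun σ => realize σ (k + 1) (subdivHomotopy bary (k + 1) (fundamental k))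

theorem sd_of {k : ℕ} (σ : C(stdSimplex ℝ (Fin (k + 1)), X)) :
    sd X k (of σ) = realize σ k (subdiv bary (k + 1) (fundamental k)) := by
  rw [sd, ← basis_apply, Basis.constr_basis]

theorem sdHomotopy_of {k : ℕ} (σ : C(stdSimplex ℝ (Fin (k + 1)), X)) :
    sdHomotopy X k (of σ) = realize σ (k + 1) (subdivHomotopy bary (k + 1) (fundamental k)) := by
  rw [sdHomotopy, ← basis_apply, Basis.constr_basis]

/-- Reduces statements about singular subdivision to ordered chains in one standard simplex. In
particular iterates of `sd` become iterates of `subdiv`, whose mesh is under control. -/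
theorem sd_realize {N k : ℕ} (σ : C(stdSimplex ℝ (Fin (N + 1)), X))
    (c : OrderedChain (stdSimplex ℝ (Fin (N + 1))) (k + 1)) :
    sd X k (realize σ k c) = realize σ k (subdiv bary (k + 1) c) := by
  suffices h : sd X k ∘ₗ realize σ k = realize σ k ∘ₗ subdiv bary (k + 1) from
    LinearMap.congr_fun h c
  refine Finsupp.lhom_ext' fun v => LinearMap.ext_ring ?_
  simp only [LinearMap.comp_apply, Finsupp.lsingle_apply]
  rw [realize_single, sd_of, realize_comp_affine, map_subdiv (affine_bary v),
    map_affine_fundamental]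

theorem sdHomotopy_realize {N k : ℕ} (σ : C(stdSimplex ℝ (Fin (N + 1)), X))
    (c : OrderedChain (stdSimplex ℝ (Fin (N + 1))) (k + 1)) :
    sdHomotopy X k (realize σ k c) = realize σ (k + 1) (subdivHomotopy bary (k + 1) c) := by
  suffices h : sdHomotopy X k ∘ₗ realize σ k = realize σ (k + 1) ∘ₗ subdivHomotopy bary (k + 1) from
    LinearMap.congr_fun h c
  refine Finsupp.lhom_ext' fun v => LinearMap.ext_ring ?_
  simp only [LinearMap.comp_apply, Finsupp.lsingle_apply]
  rw [realize_single, sdHomotopy_of, realize_comp_affine, map_subdivHomotopy (affine_bary v),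
    map_affine_fundamental]

theorem d_sd {k : ℕ} (c : (singularChains X).X (k + 1)) :
    ((singularChains X).d (k + 1) k).hom (sd X (k + 1) c)
      = sd X k (((singularChains X).d (k + 1) k).hom c) := by
  suffices h : ((singularChains X).d (k + 1) k).hom ∘ₗ sd X (k + 1)
      = sd X k ∘ₗ ((singularChains X).d (k + 1) k).hom from LinearMap.congr_fun h c
  refine hom_ext fun σ => ?_
  rw [LinearMap.comp_apply, LinearMap.comp_apply, sd_of, d_realize, d_subdiv, ← sd_realize,
    ← d_realize, realize_fundamental]

theorem d_sdHomotopy_zero (c : (singularChains X).X 0) :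
    ((singularChains X).d 1 0).hom (sdHomotopy X 0 c) = c - sd X 0 c := by
  suffices h : ((singularChains X).d 1 0).hom ∘ₗ sdHomotopy X 0 = LinearMap.id - sd X 0 from
    LinearMap.congr_fun h c
  refine hom_ext fun σ => ?_
  rw [LinearMap.comp_apply, LinearMap.sub_apply, LinearMap.id_apply, sdHomotopy_of, d_realize,
    d_subdivHomotopy_succ, sd_of, map_sub, map_sub, realize_fundamental]
  -- The remaining term is the homotopy in augmented degree 0, which is zero by definition.
  simp [subdivHomotopy]

theorem d_sdHomotopy_succ {k : ℕ} (c : (singularChains X).X (k + 1)) :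
    ((singularChains X).d (k + 2) (k + 1)).hom (sdHomotopy X (k + 1) c)
      = c - sd X (k + 1) c - sdHomotopy X k (((singularChains X).d (k + 1) k).hom c) := by
  suffices h : ((singularChains X).d (k + 2) (k + 1)).hom ∘ₗ sdHomotopy X (k + 1)
      = LinearMap.id - sd X (k + 1) - sdHomotopy X k ∘ₗ ((singularChains X).d (k + 1) k).hom from
    LinearMap.congr_fun h c
  refine hom_ext fun σ => ?_
  rw [LinearMap.comp_apply, LinearMap.sub_apply, LinearMap.sub_apply, LinearMap.comp_apply,
    LinearMap.id_apply, sdHomotopy_of, d_realize, d_subdivHomotopy_succ, sd_of, map_sub, map_sub,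
    realize_fundamental, ← sdHomotopy_realize, ← d_realize, realize_fundamental]

/-! ### Small chains -/

/-- The chains whose simplices are contained in `A`. -/
def chainsIn (A : Set X) (k : ℕ) : Submodule ℚ ((singularChains X).X k) :=
  Submodule.span ℚ (basis X k '' {σ | Set.range σ ⊆ A})

theorem realize_mem_chainsIn {A : Set X} {N : ℕ} {σ : C(stdSimplex ℝ (Fin (N + 1)), X)}
    (hσ : Set.range σ ⊆ A) {k : ℕ} (c : OrderedChain (stdSimplex ℝ (Fin (N + 1))) (k + 1)) :
    realize σ k c ∈ chainsIn A k := by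
  rw [realize, Finsupp.linearCombination_apply]
  refine Submodule.sum_mem _ fun v _ => Submodule.smul_mem _ _ (Submodule.subset_span
    ⟨σ.comp (affine v), ?_, basis_apply _⟩)
  rintro _ ⟨t, rfl⟩
  exact hσ ⟨_, rfl⟩

theorem map_mem_chainsIn {A : Set X} {k l : ℕ}
    (φ : (singularChains X).X k →ₗ[ℚ] (singularChains X).X l)
    (hφ : ∀ σ : C(stdSimplex ℝ (Fin (k + 1)), X), Set.range σ ⊆ A → φ (of σ) ∈ chainsIn A l)
    {c : (singularChains X).X k} (hc : c ∈ chainsIn A k) : φ c ∈ chainsIn A l := by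
  refine (Submodule.span_le (p := (chainsIn A l).comap φ)).2 ?_ hc
  rintro _ ⟨σ, hσ, rfl⟩
  rw [basis_apply]
  exact hφ σ hσ

/-- The sums of a chain in `A` and a chain in `B`. -/
def smallChains (A B : Set X) (k : ℕ) : Submodule ℚ ((singularChains X).X k) :=
  chainsIn A k ⊔ chainsIn B k

theorem map_mem_smallChains {A B : Set X} {k l : ℕ}
    (φ : (singularChains X).X k →ₗ[ℚ] (singularChains X).X l)
    (hφ : ∀ (S : Set X) (σ : C(stdSimplex ℝ (Fin (k + 1)), X)), Set.range σ ⊆ S →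
      φ (of σ) ∈ chainsIn S l)
    {c : (singularChains X).X k} (hc : c ∈ smallChains A B k) : φ c ∈ smallChains A B l := by
  obtain ⟨a, ha, b, hb, rfl⟩ := Submodule.mem_sup.1 hc
  rw [map_add]
  exact Submodule.add_mem_sup (map_mem_chainsIn φ (hφ A) ha) (map_mem_chainsIn φ (hφ B) hb)

theorem sd_mem_smallChains {A B : Set X} {k : ℕ} {c : (singularChains X).X k}
    (hc : c ∈ smallChains A B k) : sd X k c ∈ smallChains A B k :=
  map_mem_smallChains _ (fun _ σ hσ => by rw [sd_of]; exact realize_mem_chainsIn hσ _) hc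

theorem sdHomotopy_mem_smallChains {A B : Set X} {k : ℕ} {c : (singularChains X).X k}
    (hc : c ∈ smallChains A B k) : sdHomotopy X k c ∈ smallChains A B (k + 1) :=
  map_mem_smallChains _ (fun _ σ hσ => by rw [sdHomotopy_of]; exact realize_mem_chainsIn hσ _) hc

/-- An affine simplex with edges at most ε < δ lies in the ball of radius δ around its first vertex.
-/
theorem realize_mem_smallChains {A B : Set X} {N k : ℕ} {σ : C(stdSimplex ℝ (Fin (N + 1)), X)}
    {δ : ℝ} (hδ : ∀ p, σ '' Metric.ball p δ ⊆ A ∨ σ '' Metric.ball p δ ⊆ B)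
    {c : OrderedChain (stdSimplex ℝ (Fin (N + 1))) (k + 1)} {ε : ℝ} (hε : ε < δ)
    (hc : c ∈ meshLE ε (k + 1)) :
    realize σ k c ∈ smallChains A B k := by
  refine (Submodule.span_le (p := (smallChains A B k).comap (realize σ k))).2 ?_ hc
  rintro _ ⟨w, hw, rfl⟩
  have hr : Set.range (σ.comp (affine w)) ⊆ σ '' Metric.ball (w 0) δ := by
    rintro _ ⟨t, rfl⟩
    refine ⟨_, ?_, rfl⟩
    rw [Metric.mem_ball']
    exact (dist_affine_le_const (hw 0) t).trans_lt hε
  change realize σ k (Finsupp.single w 1) ∈ smallChains A B k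
  rw [realize_single]
  rcases hδ (w 0) with h | h
  · exact Submodule.mem_sup_left (Submodule.subset_span ⟨_, hr.trans h, basis_apply _⟩)
  · exact Submodule.mem_sup_right (Submodule.subset_span ⟨_, hr.trans h, basis_apply _⟩)

/-- For a single simplex, take a Lebesgue number of the cover pulled back to the compact standard
simplex. Requiring the conclusion for all n ≥ m allows a common exponent for the summands of a
chain. -/
theorem exists_sd_iterate_mem {A B : Set X} (hA : IsOpen A) (hB : IsOpen B)
    (hAB : A ∪ B = Set.univ) {k : ℕ} (c : (singularChains X).X k) :
    ∃ m, ∀ n, m ≤ n → (sd X k)^[n] c ∈ smallChains A B k := by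
  have hc : c ∈ Submodule.span ℚ (Set.range (basis X k)) := by
    rw [Basis.span_eq]; exact Submodule.mem_top
  induction hc using Submodule.span_induction with
  | mem x hx =>
    obtain ⟨σ, rfl⟩ := hx
    obtain ⟨δ, hδ, h⟩ := lebesgue_number_lemma_of_metric (s := (Set.univ : Set (stdSimplex ℝ (Fin (k + 1)))))
      (c := fun b : Bool => σ ⁻¹' (cond b A B)) isCompact_univ
      (fun b => by cases b; exacts [hB.preimage σ.continuous, hA.preimage σ.continuous])
      (fun t _ => by
        have : σ t ∈ A ∪ B := hAB ▸ Set.mem_univ _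
        rcases this with h | h
        · exact Set.mem_iUnion.2 ⟨true, h⟩
        · exact Set.mem_iUnion.2 ⟨false, h⟩)
    have hδ' : ∀ p, σ '' Metric.ball p δ ⊆ A ∨ σ '' Metric.ball p δ ⊆ B := fun p => by
      obtain ⟨b, hb⟩ := h p (Set.mem_univ _)
      cases b
      · exact Or.inr (Set.image_subset_iff.2 hb)
      · exact Or.inl (Set.image_subset_iff.2 hb)
    obtain ⟨m, hm⟩ := exists_subdiv_iterate_mem_meshLE
      (fun i : Fin (k + 1) => (stdSimplex.vertex i : stdSimplex ℝ (Fin (k + 1)))) (half_pos hδ)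
    refine ⟨m, fun n hn => ?_⟩
    have hiter : ∀ n, (sd X k)^[n] (basis X k σ)
        = realize σ k ((subdiv bary (k + 1))^[n] (fundamental k)) := by
      intro n
      induction n with
      | zero => simp [realize_fundamental]
      | succ n ih => rw [Function.iterate_succ_apply', Function.iterate_succ_apply', ih, sd_realize]
    rw [hiter]
    exact realize_mem_smallChains hδ' (half_lt_self hδ) (hm n hn)
  | zero => exact ⟨0, fun n _ => by rw [iterate_map_zero]; exact Submodule.zero_mem _⟩
  | add x y _ _ hx hy =>
    obtain ⟨m, hm⟩ := hx
    obtain ⟨m', hm'⟩ := hy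
    refine ⟨max m m', fun n hn => ?_⟩
    rw [iterate_map_add]
    exact Submodule.add_mem _ (hm n (le_of_max_le_left hn)) (hm' n (le_of_max_le_right hn))
  | smul a x _ hx =>
    obtain ⟨m, hm⟩ := hx
    refine ⟨m, fun n hn => ?_⟩
    rw [← Module.End.pow_apply, map_smul, Module.End.pow_apply]
    exact Submodule.smul_mem _ _ (hm n hn)

/-- A chain whose boundary is small is small up to a boundary. -/
theorem exists_sub_d_mem_smallChains {A B : Set X} (hA : IsOpen A) (hB : IsOpen B)
    (hAB : A ∪ B = Set.univ) {k : ℕ} (c : (singularChains X).X k)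
    (hc : ∀ j, k = j + 1 → ((singularChains X).d k j).hom c ∈ smallChains A B j) :
    ∃ s : (singularChains X).X (k + 1),
      c - ((singularChains X).d (k + 1) k).hom s ∈ smallChains A B k := by
  -- By the homotopy formula c − sd c − dH(c) equals H(dc), which is small because dc is; in degree
  -- 0 it vanishes. One subdivision therefore changes c only by a boundary and a small chain.
  have step : ∀ c : (singularChains X).X k,
      (∀ j, k = j + 1 → ((singularChains X).d k j).hom c ∈ smallChains A B j) →
      (∀ j, k = j + 1 → ((singularChains X).d k j).hom (sd X k c) ∈ smallChains A B j) ∧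
      c - sd X k c - ((singularChains X).d (k + 1) k).hom (sdHomotopy X k c)
        ∈ smallChains A B k := by
    intro c hc
    refine ⟨?_, ?_⟩
    · rintro j rfl
      rw [d_sd]
      exact sd_mem_smallChains (hc j rfl)
    · cases k with
      | zero => rw [d_sdHomotopy_zero, sub_self]; exact Submodule.zero_mem _
      | succ k =>
        rw [d_sdHomotopy_succ, sub_sub_cancel]
        exact sdHomotopy_mem_smallChains (hc k rfl)
  obtain ⟨m, hm⟩ := exists_sd_iterate_mem hA hB hAB c
  replace hm := hm m le_rfl
  induction m generalizing c with
  | zero => exact ⟨0, by simpa using hm⟩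
  | succ m ih =>
    obtain ⟨h1, h2⟩ := step c hc
    obtain ⟨s, hs⟩ := ih (sd X k c) h1 (by rwa [Function.iterate_succ_apply] at hm)
    refine ⟨sdHomotopy X k c + s, ?_⟩
    have := Submodule.add_mem _ h2 hs
    rw [map_add]
    convert this using 1
    abel

end SingularChain
end

noncomputable section

/-! ### Euler characteristics of complexes -/

open CategoryTheory Limits

/-- The homology of `K` is bounded and finite-dimensional in each degree, and its Euler
characteristic is `χ`. -/
def HasEulerChar (K : ChainComplex (ModuleCat.{0} ℚ) ℕ) (χ : ℤ) : Prop :=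
  (∀ n, Module.Finite ℚ (K.homology n)) ∧ ∃ N, (∀ n, N ≤ n → finrank ℚ (K.homology n) = 0) ∧
    ∑ n ∈ Finset.range N, (-1 : ℤ) ^ n * finrank ℚ (K.homology n) = χ

namespace HasEulerChar

variable {K L : ChainComplex (ModuleCat.{0} ℚ) ℕ} {χ χ' : ℤ}

theorem homologyEulerChar_eq (h : HasEulerChar K χ) : K.homologyEulerChar = χ := by
  obtain ⟨-, N, hN, rfl⟩ := h
  rw [HomologicalComplex.homologyEulerChar_eq_sum_finSet_of_finrankSupport_subset K
    (Finset.range N)]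
  · refine Finset.sum_congr rfl fun n _ => ?_
    simp
  · intro n hn
    by_contra h
    exact hn (hN n (by simpa using h))

theorem sum_range_eq (h : HasEulerChar K χ) :
    ∃ N, ∀ M, N ≤ M → finrank ℚ (K.homology M) = 0 ∧
      ∑ n ∈ Finset.range M, (-1 : ℤ) ^ n * finrank ℚ (K.homology n) = χ := by
  obtain ⟨-, N, hN, rfl⟩ := h
  refine ⟨N, fun M hM => ⟨hN M hM, ?_⟩⟩
  refine (Finset.sum_subset (by simpa using hM) fun n _ hn => ?_).symm
  rw [hN n (by simpa using hn)]
  simp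

theorem of_homologyIso (h : HasEulerChar K χ) (e : ∀ n, K.homology n ≅ L.homology n) :
    HasEulerChar L χ := by
  obtain ⟨hf, N, hN, hχ⟩ := h
  have hr : ∀ n, finrank ℚ (L.homology n) = finrank ℚ (K.homology n) := fun n =>
    (LinearEquiv.finrank_eq (e n).toLinearEquiv).symm
  refine ⟨fun n => ?_, N, fun n hn => ?_, ?_⟩
  · have := hf n
    exact Module.Finite.equiv (e n).toLinearEquiv
  · rw [hr, hN n hn]
  · simpa only [hr] using hχ

theorem of_exactAt (h : ∀ n, K.ExactAt n) : HasEulerChar K 0 := by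
  have hs : ∀ n, Subsingleton (K.homology n) := fun n =>
    ModuleCat.subsingleton_of_isZero (h n).isZero_homology
  exact ⟨fun n => inferInstance, 0, fun n _ => finrank_zero_of_subsingleton, by simp⟩

/-- The ranks r of the connecting maps occur in adjacent degrees with opposite signs and telescope,
leaving only the term at N. -/
theorem sum_alternating (a b r : ℕ → ℕ) (h0 : r 0 = 0) (N : ℕ) :
    ∑ n ∈ Finset.range N, (-1 : ℤ) ^ n * ((a n + b n : ℕ) : ℤ)
      = ∑ n ∈ Finset.range N, (-1 : ℤ) ^ n * ((a n + r (n + 1) : ℕ) : ℤ)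
        + ∑ n ∈ Finset.range N, (-1 : ℤ) ^ n * ((b n + r n : ℕ) : ℤ) + (-1) ^ N * r N := by
  induction N with
  | zero => simp [h0]
  | succ N ih =>
    rw [Finset.sum_range_succ, Finset.sum_range_succ, Finset.sum_range_succ, ih]
    push_cast
    ring

/-! ### Additivity in short exact sequences of complexes. -/

section ShortExact

variable {S : ShortComplex (ChainComplex (ModuleCat.{0} ℚ) ℕ)} (hS : S.ShortExact)
include hS

theorem range_eq_ker₂ (n : ℕ) :
    LinearMap.range (HomologicalComplex.homologyMap S.f n).hom
      = LinearMap.ker (HomologicalComplex.homologyMap S.g n).hom :=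
  (hS.homology_exact₂ n).moduleCat_range_eq_ker

theorem range_eq_ker₃ (n : ℕ) :
    LinearMap.range (HomologicalComplex.homologyMap S.g (n + 1)).hom
      = LinearMap.ker (hS.δ (n + 1) n rfl).hom :=
  (hS.homology_exact₃ (n + 1) n rfl).moduleCat_range_eq_ker

theorem range_eq_ker₁ (n : ℕ) :
    LinearMap.range (hS.δ (n + 1) n rfl).hom
      = LinearMap.ker (HomologicalComplex.homologyMap S.f n).hom :=
  (hS.homology_exact₁ (n + 1) n rfl).moduleCat_range_eq_ker

theorem range_eq_top_zero :
    LinearMap.range (HomologicalComplex.homologyMap S.g 0).hom = ⊤ := by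
  have := hS.epi_g
  have : Epi (HomologicalComplex.homologyMap S.g 0) :=
    HomologicalComplex.epi_homologyMap_of_epi_of_not_rel _ _ (fun j h => by
      simp at h)
  exact LinearMap.range_eq_top.2 ((ModuleCat.epi_iff_surjective _).1 this)

theorem finite₂ (h₁ : ∀ n, Module.Finite ℚ (S.X₁.homology n))
    (h₃ : ∀ n, Module.Finite ℚ (S.X₃.homology n)) (n : ℕ) :
    Module.Finite ℚ (S.X₂.homology n) := by
  have := h₁ n
  have := h₃ n
  have := isNoetherian_of_range_eq_ker _ _ (range_eq_ker₂ hS n)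
  infer_instance

theorem finite₃ (h₁ : ∀ n, Module.Finite ℚ (S.X₁.homology n))
    (h₂ : ∀ n, Module.Finite ℚ (S.X₂.homology n)) (n : ℕ) :
    Module.Finite ℚ (S.X₃.homology n) := by
  have := h₂ n
  cases n with
  | zero => exact Module.Finite.of_surjective _ (LinearMap.range_eq_top.1 (range_eq_top_zero hS))
  | succ n =>
    have := h₁ n
    have := isNoetherian_of_range_eq_ker _ _ (range_eq_ker₃ hS n)
    infer_instance

theorem exists_ranks (h₁ : ∀ n, Module.Finite ℚ (S.X₁.homology n))
    (h₂ : ∀ n, Module.Finite ℚ (S.X₂.homology n)) (h₃ : ∀ n, Module.Finite ℚ (S.X₃.homology n)) :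
    ∃ a b r : ℕ → ℕ, r 0 = 0 ∧ ∀ n, finrank ℚ (S.X₁.homology n) = a n + r (n + 1) ∧
      finrank ℚ (S.X₂.homology n) = a n + b n ∧ finrank ℚ (S.X₃.homology n) = b n + r n := by
  -- Rank–nullity along the long exact sequence: a and b are the ranks of the maps induced by `S.f`
  -- and `S.g`, and r (n + 1) is the rank of the connecting map from degree n + 1 to n. Surjectivity
  -- in degree 0 gives r 0 = 0.
  refine ⟨fun n => finrank ℚ (LinearMap.range (HomologicalComplex.homologyMap S.f n).hom),
    fun n => finrank ℚ (LinearMap.range (HomologicalComplex.homologyMap S.g n).hom),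
    fun n => match n with
      | 0 => 0
      | n + 1 => finrank ℚ (LinearMap.ker (HomologicalComplex.homologyMap S.f n).hom),
    rfl, fun n => ⟨?_, ?_, ?_⟩⟩
  · have := h₁ n
    exact (LinearMap.finrank_range_add_finrank_ker _).symm
  · have := h₂ n
    rw [← LinearMap.finrank_range_add_finrank_ker (HomologicalComplex.homologyMap S.g n).hom,
      ← range_eq_ker₂ hS, add_comm]
  · have := h₃ n
    cases n with
    | zero =>
      dsimp only
      rw [range_eq_top_zero hS, finrank_top, add_zero]
    | succ n =>
      dsimp only
      rw [← range_eq_ker₁ hS, range_eq_ker₃ hS]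
      exact ((add_comm _ _).trans (LinearMap.finrank_range_add_finrank_ker _)).symm

theorem middle {χ₁ χ₃ : ℤ} (h₁ : HasEulerChar S.X₁ χ₁) (h₃ : HasEulerChar S.X₃ χ₃) :
    HasEulerChar S.X₂ (χ₁ + χ₃) := by
  have hf₂ := finite₂ hS h₁.1 h₃.1
  obtain ⟨a, b, r, h0, hr⟩ := exists_ranks hS h₁.1 hf₂ h₃.1
  obtain ⟨N₁, hN₁⟩ := h₁.sum_range_eq
  obtain ⟨N₃, hN₃⟩ := h₃.sum_range_eq
  refine ⟨hf₂, max N₁ N₃, fun n hn => ?_, ?_⟩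
  · have e1 := (hN₁ n (le_of_max_le_left hn)).1
    have e3 := (hN₃ n (le_of_max_le_right hn)).1
    obtain ⟨k1, k2, k3⟩ := hr n
    omega
  · have e1 := (hN₁ _ (le_max_left N₁ N₃)).2
    have e3 := hN₃ _ (le_max_right N₁ N₃)
    have hz : r (max N₁ N₃) = 0 := by
      have := (hr (max N₁ N₃)).2.2
      omega
    rw [← e1, ← e3.2]
    simp only [fun n => (hr n).1, fun n => (hr n).2.1, fun n => (hr n).2.2]
    rw [sum_alternating a b r h0, hz]
    simp

theorem right {χ₁ χ₂ : ℤ} (h₁ : HasEulerChar S.X₁ χ₁) (h₂ : HasEulerChar S.X₂ χ₂) :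
    HasEulerChar S.X₃ (χ₂ - χ₁) := by
  have hf₃ := finite₃ hS h₁.1 h₂.1
  obtain ⟨a, b, r, h0, hr⟩ := exists_ranks hS h₁.1 h₂.1 hf₃
  obtain ⟨N₁, hN₁⟩ := h₁.sum_range_eq
  obtain ⟨N₂, hN₂⟩ := h₂.sum_range_eq
  -- The connecting map in degree n lands in degree n − 1 of `S.X₁`, so its vanishing is only known
  -- one degree later.
  have hz : ∀ n, max N₁ N₂ + 1 ≤ n → r n = 0 := fun n hn => by
    obtain ⟨m, rfl⟩ : ∃ m, n = m + 1 := ⟨n - 1, by omega⟩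
    have e1 := (hN₁ m (by omega)).1
    have := (hr m).1
    omega
  refine ⟨hf₃, max N₁ N₂ + 1, fun n hn => ?_, ?_⟩
  · have e2 := (hN₂ n (by omega)).1
    have := hz n hn
    obtain ⟨k1, k2, k3⟩ := hr n
    omega
  · have e1 := (hN₁ (max N₁ N₂ + 1) (by omega)).2
    have e2 := (hN₂ (max N₁ N₂ + 1) (by omega)).2
    rw [← e1, ← e2]
    simp only [fun n => (hr n).1, fun n => (hr n).2.1, fun n => (hr n).2.2]
    rw [sum_alternating a b r h0, hz _ le_rfl]
    simp

end ShortExact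

theorem biprod {M N : ChainComplex (ModuleCat.{0} ℚ) ℕ} (h : HasEulerChar M χ)
    (h' : HasEulerChar N χ') : HasEulerChar (M ⊞ N) (χ + χ') :=
  middle (ShortComplex.Splitting.ofHasBinaryBiproduct M N).shortExact h h'

/-! ### Mayer–Vietoris for complexes. -/

section MayerVietoris

variable {P M N X : ChainComplex (ModuleCat.{0} ℚ) ℕ} (f : P ⟶ M) (g : P ⟶ N) (h : M ⟶ X)
  (k : N ⟶ X)

theorem biprod_desc_apply (n : ℕ) (x : (M ⊞ N).X n) :
    ((biprod.desc h k).f n).hom x = (h.f n).hom (((biprod.fst : M ⊞ N ⟶ M).f n).hom x)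
      + (k.f n).hom (((biprod.snd : M ⊞ N ⟶ N).f n).hom x) := by
  rw [biprod.desc_eq]
  rfl

theorem biprod_ext_apply {n : ℕ} {x y : (M ⊞ N).X n}
    (h₁ : ((biprod.fst : M ⊞ N ⟶ M).f n).hom x = ((biprod.fst : M ⊞ N ⟶ M).f n).hom y)
    (h₂ : ((biprod.snd : M ⊞ N ⟶ N).f n).hom x = ((biprod.snd : M ⊞ N ⟶ N).f n).hom y) : x = y := by
  have e : ∀ z : (M ⊞ N).X n, z = ((biprod.inl : M ⟶ M ⊞ N).f n).hom
      (((biprod.fst : M ⊞ N ⟶ M).f n).hom z) + ((biprod.inr : N ⟶ M ⊞ N).f n).hom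
      (((biprod.snd : M ⊞ N ⟶ N).f n).hom z) := fun z =>
    (congrArg (fun φ : M ⊞ N ⟶ M ⊞ N => (φ.f n).hom z) biprod.total).symm
  rw [e x, e y, h₁, h₂]

theorem biprod_lift_fst_apply {n : ℕ} (x : P.X n) :
    ((biprod.fst : M ⊞ N ⟶ M).f n).hom (((biprod.lift f g).f n).hom x) = (f.f n).hom x :=
  congrArg (fun φ : P ⟶ M => (φ.f n).hom x) (biprod.lift_fst f g)

theorem biprod_lift_snd_apply {n : ℕ} (x : P.X n) :
    ((biprod.snd : M ⊞ N ⟶ N).f n).hom (((biprod.lift f g).f n).hom x) = (g.f n).hom x :=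
  congrArg (fun φ : P ⟶ N => (φ.f n).hom x) (biprod.lift_snd f g)

theorem exists_biprod_desc_apply_eq (n : ℕ) (a : M.X n) (b : N.X n) :
    ∃ x, ((biprod.desc h k).f n).hom x = (h.f n).hom a + (k.f n).hom b := by
  refine ⟨((biprod.inl : M ⟶ M ⊞ N).f n).hom a + ((biprod.inr : N ⟶ M ⊞ N).f n).hom b, ?_⟩
  rw [map_add]
  exact congrArg₂ (· + ·)
    (congrArg (fun φ : M ⟶ X => (φ.f n).hom a) (biprod.inl_desc h k))
    (congrArg (fun φ : N ⟶ X => (φ.f n).hom b) (biprod.inr_desc h k))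

theorem exact_of_forall_apply {φ : P ⟶ M} {ψ : M ⟶ X} (w : φ ≫ ψ = 0)
    (H : ∀ n (x : M.X n), (ψ.f n).hom x = 0 → ∃ p, (φ.f n).hom p = x) :
    (ShortComplex.mk φ ψ w).Exact :=
  HomologicalComplex.exact_of_degreewise_exact _ fun n =>
    (ShortComplex.moduleCat_exact_iff _).2 fun x hx => H n x hx

theorem exists_apply_eq_of_exact {φ : P ⟶ M} {ψ : M ⟶ X} (w : φ ≫ ψ = 0)
    (H : (ShortComplex.mk φ ψ w).Exact) {n : ℕ} (x : M.X n) (hx : (ψ.f n).hom x = 0) :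
    ∃ p, (φ.f n).hom p = x :=
  (ShortComplex.moduleCat_exact_iff _).1
    ((HomologicalComplex.exact_iff_degreewise_exact _).1 H n) x hx

/-- Quantifying over j with n = j + 1 imposes no cycle condition in degree 0, where the outgoing
differential is zero. -/
theorem exactAt_of_forall_apply (n : ℕ)
    (H : ∀ x : X.X n, (∀ j, n = j + 1 → (X.d n j).hom x = 0) → ∃ y, (X.d (n + 1) n).hom y = x) :
    X.ExactAt n := by
  rw [HomologicalComplex.exactAt_iff' X (n + 1) n ((ComplexShape.down ℕ).next n) (by simp) rfl,
    ShortComplex.moduleCat_exact_iff]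
  intro x hx
  refine H x ?_
  rintro j rfl
  have : (ComplexShape.down ℕ).next (j + 1) = j := by simp
  rw [this] at hx
  exact hx

/-- Additivity of the Euler characteristic for a Mayer–Vietoris square of complexes in which `X` is
only up to quasi-isomorphism the sum of `M` and `N`. -/
theorem mayerVietoris {χP χM χN : ℤ} (w : f ≫ h = g ≫ k)
    (inj : ∀ n, Function.Injective (f.f n).hom)
    (exact : ∀ n a b, (h.f n).hom a = (k.f n).hom b →
      ∃ p, (f.f n).hom p = a ∧ (g.f n).hom p = b)
    (small : ∀ n (x : X.X n),
      (∀ j, n = j + 1 → ∃ a b, (X.d n j).hom x = (h.f j).hom a + (k.f j).hom b) →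
      ∃ s a b, x - (X.d (n + 1) n).hom s = (h.f n).hom a + (k.f n).hom b)
    (hP : HasEulerChar P χP) (hM : HasEulerChar M χM) (hN : HasEulerChar N χN) :
    HasEulerChar X (χM + χN - χP) := by
  set φ : M ⊞ N ⟶ X := biprod.desc h k with hφ
  set ψ : P ⟶ M ⊞ N := biprod.lift f (-g) with hψ
  have hψφ : ψ ≫ φ = 0 := by
    rw [hψ, hφ, biprod.lift_desc, w]
    simp
  have hex : (ShortComplex.mk ψ φ hψφ).Exact := by
    refine exact_of_forall_apply _ fun n x hx' => ?_
    rw [hφ, biprod_desc_apply] at hx'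
    obtain ⟨p, hp1, hp2⟩ := exact n (((biprod.fst : M ⊞ N ⟶ M).f n).hom x)
      (-((biprod.snd : M ⊞ N ⟶ N).f n).hom x)
      (by rw [map_neg]; exact eq_neg_of_add_eq_zero_left hx')
    refine ⟨p, ?_⟩
    refine biprod_ext_apply ?_ ?_
    · rw [hψ, biprod_lift_fst_apply, hp1]
    · rw [hψ, biprod_lift_snd_apply]
      change -(g.f n).hom p = _
      rw [hp2, neg_neg]
  have hmono : Mono ψ := by
    have : ∀ n, Mono (ψ.f n) := fun n => by
      rw [ModuleCat.mono_iff_injective]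
      intro x y hxy
      refine inj n ?_
      rw [← biprod_lift_fst_apply f (-g), ← biprod_lift_fst_apply f (-g)]
      exact congrArg _ hxy
    exact HomologicalComplex.mono_of_mono_f _ this
  have hπ : (ShortComplex.mk φ (cokernel.π φ) (cokernel.condition φ)).Exact :=
    ShortComplex.exact_of_g_is_cokernel _ (cokernelIsCokernel φ)
  have hsurj : ∀ n, Function.Surjective ((cokernel.π φ).f n).hom := fun n =>
    (ModuleCat.epi_iff_surjective _).1 inferInstance
  have hφπ : ∀ n (x : (M ⊞ N).X n), ((cokernel.π φ).f n).hom ((φ.f n).hom x) = 0 := fun n x =>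
    congrArg (fun θ : M ⊞ N ⟶ cokernel φ => (θ.f n).hom x) (cokernel.condition φ)
  have hdπ : ∀ (i j : ℕ) (x : X.X i), ((cokernel φ).d i j).hom (((cokernel.π φ).f i).hom x)
      = ((cokernel.π φ).f j).hom ((X.d i j).hom x) := fun i j x =>
    congrArg (fun θ : X.X i ⟶ (cokernel φ).X j => θ.hom x) ((cokernel.π φ).comm i j)
  -- A cycle of the cokernel lifts to a chain of `X` whose boundary comes from `M` and `N`. By
  -- `small` it differs from a boundary by a chain in the image of φ, so the cokernel is acyclic.
  have hQ : HasEulerChar (cokernel φ) 0 := by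
    refine of_exactAt fun n => exactAt_of_forall_apply n fun q hq => ?_
    obtain ⟨x, rfl⟩ := hsurj n q
    obtain ⟨s, a, b, hs⟩ := small n x fun j hj => by
      have h0 := hq j hj
      rw [hdπ] at h0
      obtain ⟨y, hy⟩ := exists_apply_eq_of_exact _ hπ _ h0
      rw [← hy, hφ]
      exact ⟨_, _, biprod_desc_apply h k j y⟩
    refine ⟨((cokernel.π φ).f (n + 1)).hom s, ?_⟩
    obtain ⟨y, hy⟩ := exists_biprod_desc_apply_eq h k n a b
    rw [hdπ, eq_comm, ← sub_eq_zero, ← map_sub, hs, ← hy]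
    exact hφπ n y
  -- `X` is an extension of the acyclic cokernel by the image of φ, and this image is the quotient
  -- of `M ⊞ N` by `P`. The image is taken as the kernel of the cokernel map, so that the two
  -- sequences fit together.
  have hS₂ : (ShortComplex.mk (kernel.ι (cokernel.π φ)) (cokernel.π φ)
      (kernel.condition _)).ShortExact :=
    { exact := ShortComplex.exact_of_f_is_kernel _ (kernelIsKernel _) }
  have hS₁ : (ShortComplex.mk ψ (Abelian.factorThruImage φ) (by
      rw [← cancel_mono (Abelian.image.ι φ), Category.assoc, Abelian.image.fac, hψφ,
        zero_comp])).ShortExact :=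
    { exact := by
        refine exact_of_forall_apply _ fun n x hx => exists_apply_eq_of_exact _ hex x ?_
        have h1 : (φ.f n).hom x = ((Abelian.image.ι φ).f n).hom
            (((Abelian.factorThruImage φ).f n).hom x) :=
          congrArg (fun θ : M ⊞ N ⟶ X => (θ.f n).hom x) (Abelian.image.fac φ).symm
        rw [h1, hx, map_zero] }
  have hK := right hS₁ hP (biprod hM hN)
  have := middle hS₂ hK hQ
  rwa [add_zero] at this

end MayerVietoris

end HasEulerChar
end

noncomputable section

/-! ### Euler characteristics of spaces -/

open CategoryTheory Limits

namespace SingularChain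

variable {X Y : Type} [TopologicalSpace X] [TopologicalSpace Y]

theorem map_basis_repr {k : ℕ} (f : C(X, Y)) (c : (singularChains X).X k) :
    (basis Y k).repr (((singularChainsMap f).f k).hom c)
      = Finsupp.mapDomain (fun σ => f.comp σ) ((basis X k).repr c) := by
  suffices h : (basis Y k).repr.toLinearMap ∘ₗ ((singularChainsMap f).f k).hom
      = Finsupp.lmapDomain ℚ ℚ (fun σ => f.comp σ) ∘ₗ (basis X k).repr.toLinearMap from
    LinearMap.congr_fun h c
  refine (basis X k).ext fun σ => ?_
  simp only [LinearMap.comp_apply, LinearEquiv.coe_coe, Basis.repr_self, Finsupp.lmapDomain_apply,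
    Finsupp.mapDomain_single]
  rw [basis_apply, map_of, ← basis_apply, Basis.repr_self]

theorem map_injective {f : C(X, Y)} (hf : Function.Injective f) (k : ℕ) :
    Function.Injective ((singularChainsMap f).f k).hom := by
  intro a b hab
  have h := congrArg (basis Y k).repr hab
  rw [map_basis_repr, map_basis_repr] at h
  refine (basis X k).repr.injective (Finsupp.mapDomain_injective (fun σ σ' h => ?_) h)
  exact ContinuousMap.ext fun t => hf (DFunLike.congr_fun h t)

theorem map_mem_chainsIn_range (f : C(X, Y)) {k : ℕ} (c : (singularChains X).X k) :
    ((singularChainsMap f).f k).hom c ∈ chainsIn (Set.range f) k := by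
  have hc : c ∈ Submodule.span ℚ (Set.range (basis X k)) := by
    rw [Basis.span_eq]; exact Submodule.mem_top
  refine (Submodule.span_le (p := (chainsIn (Set.range f) k).comap
    ((singularChainsMap f).f k).hom)).2 ?_ hc
  rintro _ ⟨σ, rfl⟩
  refine Submodule.subset_span ⟨f.comp σ, ?_, ?_⟩
  · rintro _ ⟨t, rfl⟩
    exact ⟨_, rfl⟩
  · rw [basis_apply, basis_apply, map_of]

theorem exists_map_eq_of_mem_chainsIn {f : C(X, Y)} (hf : Topology.IsEmbedding f) {k : ℕ}
    {c : (singularChains Y).X k} (hc : c ∈ chainsIn (Set.range f) k) :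
    ∃ a, ((singularChainsMap f).f k).hom a = c := by
  refine (Submodule.span_le (p := LinearMap.range ((singularChainsMap f).f k).hom)).2 ?_ hc
  rintro _ ⟨σ, hσ, rfl⟩
  let τ : C(stdSimplex ℝ (Fin (k + 1)), X) :=
    ⟨fun t => hf.toHomeomorph.symm ⟨σ t, hσ ⟨t, rfl⟩⟩,
      hf.toHomeomorph.symm.continuous.comp (σ.continuous.subtype_mk _)⟩
  have hτ : f.comp τ = σ := ContinuousMap.ext fun t =>
    congrArg Subtype.val (hf.toHomeomorph.apply_symm_apply ⟨σ t, hσ ⟨t, rfl⟩⟩)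
  exact ⟨of τ, by rw [map_of, hτ, basis_apply]⟩

/-- Both spans are generated by parts of one basis, so membership is a condition on the support. -/
theorem mem_chainsIn_inter {A B : Set X} {k : ℕ} {c : (singularChains X).X k}
    (hA : c ∈ chainsIn A k) (hB : c ∈ chainsIn B k) : c ∈ chainsIn (A ∩ B) k := by
  rw [chainsIn, Basis.mem_span_image] at *
  exact fun σ hσ => Set.subset_inter (hA hσ) (hB hσ)

end SingularChain

/-- The rational singular homology of `X` is finite-dimensional, and the Euler characteristic of
`X` is `χ`. -/
def HasChi (X : Type) [TopologicalSpace X] (χ : ℤ) : Prop :=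
  HasEulerChar (singularChains X) χ

namespace HasChi

variable {X Y : Type} [TopologicalSpace X] [TopologicalSpace Y] {χ : ℤ}

theorem homologyMap_eq {f g : C(X, Y)} (H : f.Homotopic g) (n : ℕ) :
    HomologicalComplex.homologyMap (singularChainsMap f) n
      = HomologicalComplex.homologyMap (singularChainsMap g) n :=
  TopCat.Homotopy.congr_homologyMap_singularChainComplexFunctor
    (f := TopCat.ofHom f) (g := TopCat.ofHom g) H.some _ n

theorem homologyMap_comp_eq_id {f : C(X, Y)} {g : C(Y, X)}
    (H : (g.comp f).Homotopic (ContinuousMap.id X)) (n : ℕ) :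
    HomologicalComplex.homologyMap (singularChainsMap f) n ≫
      HomologicalComplex.homologyMap (singularChainsMap g) n = 𝟙 _ := by
  rw [← HomologicalComplex.homologyMap_comp, ← Functor.map_comp]
  refine (homologyMap_eq H n).trans ?_
  have : singularChainsMap (ContinuousMap.id X) = 𝟙 (singularChains X) :=
    CategoryTheory.Functor.map_id _ _
  rw [this, HomologicalComplex.homologyMap_id]

theorem of_homotopyEquiv (h : HasChi X χ) (e : ContinuousMap.HomotopyEquiv X Y) : HasChi Y χ :=
  h.of_homologyIso fun n =>
    { hom := HomologicalComplex.homologyMap (singularChainsMap e.toFun) n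
      inv := HomologicalComplex.homologyMap (singularChainsMap e.invFun) n
      hom_inv_id := homologyMap_comp_eq_id e.left_inv n
      inv_hom_id := homologyMap_comp_eq_id e.right_inv n }

theorem of_homeomorph (h : HasChi X χ) (e : X ≃ₜ Y) : HasChi Y χ :=
  h.of_homotopyEquiv e.toHomotopyEquiv

theorem of_isEmpty [IsEmpty X] : HasChi X 0 := by
  refine HasEulerChar.of_exactAt fun n => HasEulerChar.exactAt_of_forall_apply n fun x _ => ?_
  have : IsEmpty C(stdSimplex ℝ (Fin (n + 1)), X) :=
    ⟨fun σ => isEmptyElim (σ (stdSimplex.vertex 0))⟩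
  have : Subsingleton ((singularChains X).X n) := (SingularChain.basis X n).repr.toEquiv.subsingleton
  exact ⟨0, Subsingleton.elim _ _⟩

theorem punit : HasChi PUnit 1 := by
  have h0 : ∀ n, n ≠ 0 → Subsingleton ((singularChains PUnit).homology n) := fun n hn =>
    ModuleCat.subsingleton_of_isZero
      (AlgebraicTopology.isZero_singularHomologyFunctor_of_totallyDisconnectedSpace
        (ModuleCat.{0} ℚ) n (ModuleCat.of ℚ ℚ) (TopCat.of PUnit) hn)
  have : PathConnectedSpace (TopCat.of PUnit) := inferInstanceAs (PathConnectedSpace PUnit)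
  let e : (singularChains PUnit).homology 0 ≃ₗ[ℚ] ℚ :=
    (asIso (TopCat.singularHomology₀ε (TopCat.of PUnit) (ModuleCat.of ℚ ℚ))).toLinearEquiv
  refine ⟨fun n => ?_, 1, fun n hn => ?_, ?_⟩
  · rcases eq_or_ne n 0 with rfl | hn
    · exact Module.Finite.equiv e.symm
    · have := h0 n hn
      infer_instance
  · have := h0 n (by omega)
    exact finrank_zero_of_subsingleton
  · rw [Finset.sum_range_one, e.finrank_eq]
    simp

theorem of_contractible [ContractibleSpace X] : HasChi X 1 :=
  punit.of_homotopyEquiv (ContractibleSpace.hequiv_unit X).some.symm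

theorem prod_contractible (h : HasChi X χ) [ContractibleSpace Y] : HasChi (X × Y) χ :=
  (h.of_homeomorph (Homeomorph.prodPUnit X).symm).of_homotopyEquiv
    ((ContinuousMap.HomotopyEquiv.refl X).prodCongr (ContractibleSpace.hequiv_unit Y).some.symm)

/-- Additivity of the Euler characteristic for two open subsets that cover a space. -/
theorem mayerVietoris {P A B : Type} [TopologicalSpace P] [TopologicalSpace A] [TopologicalSpace B]
    (f : C(P, A)) (g : C(P, B)) (i : C(A, X)) (j : C(B, X)) (w : i.comp f = j.comp g)
    (hi : Topology.IsOpenEmbedding i) (hj : Topology.IsOpenEmbedding j)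
    (hif : Topology.IsEmbedding (i.comp f)) (hf : Set.range i ∩ Set.range j ⊆ Set.range (i.comp f))
    (hX : Set.range i ∪ Set.range j = Set.univ) {χP χA χB : ℤ}
    (hP : HasChi P χP) (hA : HasChi A χA) (hB : HasChi B χB) : HasChi X (χA + χB - χP) := by
  have hcomp : ∀ {Q : Type} [TopologicalSpace Q] (f : C(P, Q)) (i : C(Q, X)),
      singularChainsMap (i.comp f) = singularChainsMap f ≫ singularChainsMap i :=
    fun f i => Functor.map_comp _ (TopCat.ofHom f) (TopCat.ofHom i)
  have hcomp' : ∀ {Q : Type} [TopologicalSpace Q] (f : C(P, Q)) (i : C(Q, X)) (n : ℕ)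
      (p : (singularChains P).X n), ((singularChainsMap i).f n).hom
        (((singularChainsMap f).f n).hom p) = ((singularChainsMap (i.comp f)).f n).hom p :=
    fun f i n p => congrArg (fun θ : singularChains P ⟶ singularChains X => (θ.f n).hom p)
      (hcomp f i).symm
  have hsmall : ∀ {n : ℕ} (x : (singularChains X).X n),
      x ∈ SingularChain.smallChains (Set.range i) (Set.range j) n ↔
        ∃ a b, x = ((singularChainsMap i).f n).hom a + ((singularChainsMap j).f n).hom b := by
    intro n x
    constructor
    · intro hx
      obtain ⟨y, hy, z, hz, rfl⟩ := Submodule.mem_sup.1 hx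
      obtain ⟨a, rfl⟩ := SingularChain.exists_map_eq_of_mem_chainsIn hi.isEmbedding hy
      obtain ⟨b, rfl⟩ := SingularChain.exists_map_eq_of_mem_chainsIn hj.isEmbedding hz
      exact ⟨a, b, rfl⟩
    · rintro ⟨a, b, rfl⟩
      exact Submodule.add_mem_sup (SingularChain.map_mem_chainsIn_range i a)
        (SingularChain.map_mem_chainsIn_range j b)
  refine HasEulerChar.mayerVietoris (singularChainsMap f) (singularChainsMap g)
    (singularChainsMap i) (singularChainsMap j) ?_ ?_ ?_ ?_ hP hA hB
  · rw [← hcomp, ← hcomp, w]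
  · refine SingularChain.map_injective (Function.Injective.of_comp (f := i) ?_)
    exact hif.injective
  · intro n a b hab
    have ha := SingularChain.map_mem_chainsIn_range i a
    have hb := SingularChain.map_mem_chainsIn_range j b
    rw [← hab] at hb
    obtain ⟨p, hp⟩ := SingularChain.exists_map_eq_of_mem_chainsIn hif
      (Submodule.span_mono (Set.image_mono fun σ hσ => hσ.trans hf)
        (SingularChain.mem_chainsIn_inter ha hb))
    refine ⟨p, SingularChain.map_injective hi.injective n ?_,
      SingularChain.map_injective hj.injective n ?_⟩
    · rw [hcomp', hp]
    · rw [hcomp', ← w, hp, hab]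
  · intro n x hx
    obtain ⟨s, hs⟩ := SingularChain.exists_sub_d_mem_smallChains hi.isOpen_range hj.isOpen_range hX
      x fun j hj => (hsmall _).2 (hx j hj)
    exact ⟨s, (hsmall _).1 hs⟩

/-- Additivity of the Euler characteristic for the union of two open subsets. -/
theorem union {A B : Set X} (hA : IsOpen A) (hB : IsOpen B) {χA χB χP : ℤ} (h : HasChi A χA)
    (h' : HasChi B χB) (h'' : HasChi (A ∩ B : Set X) χP) :
    HasChi (A ∪ B : Set X) (χA + χB - χP) := by
  refine mayerVietoris (X := (A ∪ B : Set X))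
    ⟨_, continuous_inclusion (Set.inter_subset_left : A ∩ B ⊆ A)⟩
    ⟨_, continuous_inclusion (Set.inter_subset_right : A ∩ B ⊆ B)⟩
    ⟨_, continuous_inclusion (Set.subset_union_left : A ⊆ A ∪ B)⟩
    ⟨_, continuous_inclusion (Set.subset_union_right : B ⊆ A ∪ B)⟩ rfl ?_ ?_ ?_ ?_ ?_ h'' h h'
  · exact Topology.IsOpenEmbedding.inclusion Set.subset_union_left (hA.preimage continuous_subtype_val)
  · exact Topology.IsOpenEmbedding.inclusion Set.subset_union_right (hB.preimage continuous_subtype_val)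
  · exact Topology.IsEmbedding.inclusion (Set.inter_subset_left.trans Set.subset_union_left)
  · rintro _ ⟨⟨x, rfl⟩, ⟨y, hy⟩⟩
    have hxy : (y : X) = x := congrArg Subtype.val hy
    exact ⟨⟨x, x.2, hxy ▸ y.2⟩, rfl⟩
  · refine Set.eq_univ_of_forall fun x => ?_
    rcases x.2 with hx | hx
    · exact Or.inl ⟨⟨x, hx⟩, rfl⟩
    · exact Or.inr ⟨⟨x, hx⟩, rfl⟩

end HasChi
end

noncomputable section

/-! ### Products of lines and punctured lines -/

namespace HasChi

variable {X Y : Type} [TopologicalSpace X] [TopologicalSpace Y] {χ : ℤ}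

/-- Carrying an arbitrary factor `X` through Mayer–Vietoris makes a Künneth formula unnecessary for
the products of lines and punctured lines. -/
theorem prod_union {U V : Set Y} (hU : IsOpen U) (hV : IsOpen V) {a b c : ℤ}
    (h : HasChi (X × U) a) (h' : HasChi (X × V) b) (h'' : HasChi (X × (U ∩ V : Set Y)) c) :
    HasChi (X × (U ∪ V : Set Y)) (a + b - c) := by
  have emb : ∀ {S T : Set Y} (hST : S ⊆ T), Topology.IsEmbedding
      (Prod.map (id : X → X) (Set.inclusion hST)) := fun hST =>
    Topology.IsEmbedding.id.prodMap (Topology.IsEmbedding.inclusion hST)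
  have oemb : ∀ {S T : Set Y} (hST : S ⊆ T), IsOpen S → Topology.IsOpenEmbedding
      (Prod.map (id : X → X) (Set.inclusion hST)) := fun hST hS =>
    Topology.IsOpenEmbedding.id.prodMap
      (Topology.IsOpenEmbedding.inclusion hST (hS.preimage continuous_subtype_val))
  refine mayerVietoris (X := X × (U ∪ V : Set Y))
    ⟨_, (emb (Set.inter_subset_left : U ∩ V ⊆ U)).continuous⟩
    ⟨_, (emb (Set.inter_subset_right : U ∩ V ⊆ V)).continuous⟩
    ⟨_, (emb (Set.subset_union_left : U ⊆ U ∪ V)).continuous⟩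
    ⟨_, (emb (Set.subset_union_right : V ⊆ U ∪ V)).continuous⟩ rfl ?_ ?_ ?_ ?_ ?_ h'' h h'
  · exact oemb _ hU
  · exact oemb _ hV
  · exact emb (Set.inter_subset_left.trans Set.subset_union_left)
  · rintro _ ⟨⟨⟨x, y⟩, rfl⟩, ⟨⟨x', y'⟩, h⟩⟩
    have hy : (y' : Y) = y := congrArg (fun p => (p.2 : Y)) h
    exact ⟨⟨x, y, y.2, hy ▸ y'.2⟩, rfl⟩
  · refine Set.eq_univ_of_forall fun p => ?_
    rcases p.2.2 with hx | hx
    · exact Or.inl ⟨(p.1, ⟨p.2, hx⟩), rfl⟩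
    · exact Or.inr ⟨(p.1, ⟨p.2, hx⟩), rfl⟩

theorem prod_of_eq {U V : Set Y} (h : HasChi (X × U) χ) (e : U = V) : HasChi (X × V) χ := e ▸ h

theorem prod_im_ne_zero (h : HasChi X χ) : HasChi (X × {z : ℂ | z.im ≠ 0}) (χ + χ) := by
  have h1 : ContractibleSpace {z : ℂ | 0 < z.im} :=
    (convex_halfSpace_im_gt 0).contractibleSpace ⟨Complex.I, by simp⟩
  have h2 : ContractibleSpace {z : ℂ | z.im < 0} :=
    (convex_halfSpace_im_lt 0).contractibleSpace ⟨-Complex.I, by simp⟩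
  have hempty : IsEmpty ({z : ℂ | 0 < z.im} ∩ {z : ℂ | z.im < 0} : Set ℂ) :=
    ⟨fun z => lt_asymm (show 0 < (z : ℂ).im from z.2.1) z.2.2⟩
  have := prod_union (X := X) (isOpen_lt continuous_const Complex.continuous_im)
    (isOpen_lt Complex.continuous_im continuous_const)
    (h.prod_contractible (Y := {z : ℂ | 0 < z.im}))
    (h.prod_contractible (Y := {z : ℂ | z.im < 0})) (of_isEmpty (X := X × _))
  rw [sub_zero] at this
  refine this.prod_of_eq ?_
  ext z
  simp only [Set.mem_union, Set.mem_ofPred_eq, ne_iff_lt_or_gt, or_comm]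

/-- The slit plane and its negative are contractible and cover the punctured plane; they meet in the
non-real numbers, two contractible half-planes. The count is χ + χ − 2χ. -/
theorem prod_punctured (h : HasChi X χ) : HasChi (X × {z : ℂ | z ≠ 0}) 0 := by
  have h1 : ContractibleSpace Complex.slitPlane :=
    Complex.starConvex_one_slitPlane.contractibleSpace ⟨1, Complex.one_mem_slitPlane⟩
  let e : Complex.slitPlane ≃ₜ {z : ℂ | -z ∈ Complex.slitPlane} :=
    (Homeomorph.neg ℂ).subtype fun z => by simp
  have h2 : ContractibleSpace {z : ℂ | -z ∈ Complex.slitPlane} := e.symm.contractibleSpace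
  have h3 : {z : ℂ | z.im ≠ 0} = Complex.slitPlane ∩ {z : ℂ | -z ∈ Complex.slitPlane} := by
    ext z
    simp only [Set.mem_ofPred_eq, Set.mem_inter_iff, Complex.mem_slitPlane_iff, Complex.neg_re,
      Complex.neg_im, neg_ne_zero, Left.neg_pos_iff]
    constructor
    · exact fun h => ⟨Or.inr h, Or.inr h⟩
    · rintro ⟨h | h, h' | h'⟩
      · exact absurd h' (lt_asymm h)
      · exact h'
      · exact h
      · exact h
  have := prod_union (X := X) Complex.isOpen_slitPlane
    (Complex.isOpen_slitPlane.preimage continuous_neg)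
    (h.prod_contractible (Y := Complex.slitPlane))
    (h.prod_contractible (Y := {z : ℂ | -z ∈ Complex.slitPlane})) (h.prod_im_ne_zero.prod_of_eq h3)
  rw [sub_self] at this
  refine this.prod_of_eq ?_
  ext z
  simp only [Set.mem_ofPred_eq, Set.mem_union, Set.mem_preimage, Complex.mem_slitPlane_iff,
    Complex.neg_re, Complex.neg_im, neg_ne_zero, Left.neg_pos_iff, ne_eq, Complex.ext_iff,
    Complex.zero_re, Complex.zero_im]
  constructor
  · rintro ((h | h) | h | h)
    · exact fun hz => h.ne' hz.1
    · exact fun hz => h hz.2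
    · exact fun hz => h.ne hz.1
    · exact fun hz => h hz.2
  · intro hz
    by_cases h : z.im = 0
    · rcases lt_trichotomy z.re 0 with h' | h' | h'
      · exact Or.inr (Or.inl h')
      · exact absurd ⟨h', h⟩ hz
      · exact Or.inl (Or.inl h')
    · exact Or.inl (Or.inr h)

end HasChi

/-- The points of `ℂⁿ` whose coordinates with index in `I` do not vanish. -/
def partialTorus {n : ℕ} (I : Set (Fin n)) : Set (Fin n → ℂ) := {c | ∀ i ∈ I, c i ≠ 0}

namespace HasChi

/-- Splitting off the first coordinate. -/
def partialTorusHomeomorph {n : ℕ} (I : Set (Fin (n + 1))) :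
    partialTorus {i : Fin n | i.succ ∈ I} × {z : ℂ | 0 ∈ I → z ≠ 0} ≃ₜ partialTorus I where
  toFun p := ⟨Fin.cons (α := fun _ => ℂ) p.2.1 p.1.1, fun i => Fin.cases p.2.2 p.1.2 i⟩
  invFun c := (⟨Fin.tail c.1, fun i hi => c.2 i.succ hi⟩, ⟨c.1 0, c.2 0⟩)
  left_inv p := by ext <;> simp
  right_inv c := by ext i; simp
  continuous_toFun := by
    refine Continuous.subtype_mk (continuous_pi fun i => Fin.cases ?_ (fun i => ?_) i) _
    · simp only [Fin.cons_zero]; fun_prop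
    · simp only [Fin.cons_succ]
      exact (continuous_apply i).comp (continuous_subtype_val.comp continuous_fst)
  continuous_invFun := by
    refine Continuous.prodMk (Continuous.subtype_mk (continuous_pi fun i => ?_) _)
      (Continuous.subtype_mk ?_ _)
    · exact (continuous_apply i.succ).comp continuous_subtype_val
    · exact (continuous_apply 0).comp continuous_subtype_val

-- One coordinate is split off at a time: a full line preserves the Euler characteristic, a
-- punctured line makes it zero.
open Classical in
theorem partialTorus {n : ℕ} (I : Set (Fin n)) :
    HasChi (partialTorus I) (if I = ∅ then 1 else 0) := by
  induction n with
  | zero =>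
    have hI : I = ∅ := Set.eq_empty_of_isEmpty I
    have : Unique (_root_.partialTorus I) :=
      { default := ⟨0, fun i => i.elim0⟩, uniq := fun c => Subtype.ext (Subsingleton.elim _ _) }
    rw [if_pos hI]
    exact of_contractible
  | succ n ih =>
    refine HasChi.of_homeomorph ?_ (partialTorusHomeomorph I)
    have h := ih {i : Fin n | i.succ ∈ I}
    by_cases h0 : 0 ∈ I
    · have hI : I ≠ ∅ := Set.nonempty_iff_ne_empty.1 ⟨0, h0⟩
      rw [if_neg hI]
      exact h.prod_punctured.prod_of_eq (by ext z; simp [h0])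
    · have hI : I = ∅ ↔ {i : Fin n | i.succ ∈ I} = ∅ := by
        simp only [Set.eq_empty_iff_forall_notMem, Set.mem_ofPred_eq]
        exact ⟨fun h i => h _, fun h i => Fin.cases h0 h i⟩
      have e : {z : ℂ | 0 ∈ I → z ≠ 0} = Set.univ := by ext z; simp [h0]
      have : ContractibleSpace (Set.univ : Set ℂ) := convex_univ.contractibleSpace ⟨0, trivial⟩
      simp only [hI]
      exact (h.prod_contractible (Y := (Set.univ : Set ℂ))).prod_of_eq e.symm

end HasChi
end

noncomputable section

/-! ### The charts of the toric variety -/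

theorem prod_zpow_eq_zpow_sum {ι G : Type*} [CommGroup G] (s : Finset ι) (a : G) (f : ι → ℤ) :
    ∏ i ∈ s, a ^ f i = a ^ ∑ i ∈ s, f i := by
  classical
  induction s using Finset.induction_on with
  | empty => simp
  | insert i s hi ih => rw [Finset.prod_insert hi, Finset.sum_insert hi, zpow_add, ih]

namespace ToricCY3

variable (Y : ToricCY3)

open Classical in
/-- The rays whose homogeneous coordinate vanishes. -/
def coxZeros (x : Y.CoxSpace) : Finset (Fin 3 → ℤ) :=
  (Finset.univ.filter fun ρ : Y.rays => x.1 ρ = 0).map (Function.Embedding.subtype _)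

variable {Y}

theorem mem_coxZeros {x : Y.CoxSpace} {u : Fin 3 → ℤ} :
    u ∈ Y.coxZeros x ↔ ∃ h : u ∈ Y.rays, x.1 ⟨u, h⟩ = 0 := by
  simp [coxZeros]

theorem coxZeros_subset_iff {x : Y.CoxSpace} {s : Finset (Fin 3 → ℤ)} :
    Y.coxZeros x ⊆ s ↔ ∀ ρ : Y.rays, x.1 ρ = 0 → (ρ : Fin 3 → ℤ) ∈ s :=
  ⟨fun h ρ hρ => h (mem_coxZeros.2 ⟨ρ.2, hρ⟩), fun h _ hu =>
    let ⟨h1, h2⟩ := mem_coxZeros.1 hu; h ⟨_, h1⟩ h2⟩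

theorem coxZeros_mem_cones (x : Y.CoxSpace) : Y.coxZeros x ∈ Y.cones := by
  obtain ⟨s, hs, h⟩ := x.2
  exact Y.face_mem s hs _ (coxZeros_subset_iff.2 h)

variable (Y)

/-- The rays whose homogeneous coordinate vanishes, for a point of the toric variety. -/
def zeros : Y.Space → Finset (Fin 3 → ℤ) :=
  Quotient.lift Y.coxZeros fun x y ⟨g, _, h⟩ => by
    ext u
    simp only [mem_coxZeros, h, mul_eq_zero, Units.ne_zero, false_or]

theorem zeros_mem_cones (p : Y.Space) : Y.zeros p ∈ Y.cones :=
  Quotient.inductionOn p fun x => coxZeros_mem_cones x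

/-- The affine chart of a cone. -/
def chart (s : Finset (Fin 3 → ℤ)) : Set Y.Space := {p | Y.zeros p ⊆ s}

/-- The quotient map from the homogeneous coordinates. -/
def proj : Y.CoxSpace → Y.Space := Quotient.mk Y.coxSetoid

theorem isQuotientMap_proj : Topology.IsQuotientMap Y.proj := isQuotientMap_quot_mk

theorem continuous_coord (ρ : Y.rays) : Continuous fun x : Y.CoxSpace => x.1 ρ :=
  (continuous_apply ρ).comp continuous_subtype_val

theorem proj_mem_chart {x : Y.CoxSpace} {s : Finset (Fin 3 → ℤ)} :
    Y.proj x ∈ Y.chart s ↔ ∀ ρ : Y.rays, x.1 ρ = 0 → (ρ : Fin 3 → ℤ) ∈ s :=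
  coxZeros_subset_iff

theorem isOpen_chart (s : Finset (Fin 3 → ℤ)) : IsOpen (Y.chart s) := by
  rw [← Y.isQuotientMap_proj.isOpen_preimage]
  have : Y.proj ⁻¹' Y.chart s
      = ⋂ ρ : Y.rays, {x : Y.CoxSpace | (ρ : Fin 3 → ℤ) ∉ s → x.1 ρ ≠ 0} := by
    ext x
    simp only [Set.mem_preimage, proj_mem_chart, Set.mem_iInter, Set.mem_ofPred_eq]
    exact forall_congr' fun ρ => not_imp_not.symm
  rw [this]
  refine isOpen_iInter_of_finite fun ρ => ?_
  by_cases h : (ρ : Fin 3 → ℤ) ∈ s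
  · simp [h]
  · simpa [h] using isOpen_ne.preimage (Y.continuous_coord ρ)

/-- The generators of a three-dimensional cone already form a ℤ-basis. These relations provide the
exponents that lift chart coordinates to homogeneous ones. -/
theorem exists_sum_smul_rays (n : Fin 3 → ℤ) :
    ∃ l : Y.rays → ℤ, ∑ ρ : Y.rays, l ρ • (ρ : Fin 3 → ℤ) = n := by
  obtain ⟨s, hs, hc⟩ := Y.exists_maximal
  obtain ⟨B, hB⟩ := Y.range_eq_of_mem_vertices (Finset.mem_filter.2 ⟨hs, hc⟩)
  have hsub : Set.range B ⊆ Set.range (fun ρ : Y.rays => (ρ : Fin 3 → ℤ)) := by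
    rw [← hB]
    exact fun u hu => ⟨⟨u, Finset.mem_biUnion.2 ⟨s, hs, hu⟩⟩, rfl⟩
  have : n ∈ Submodule.span ℤ (Set.range (fun ρ : Y.rays => (ρ : Fin 3 → ℤ))) := by
    refine Submodule.span_mono hsub ?_
    rw [B.span_eq]
    exact Submodule.mem_top
  exact (Submodule.mem_span_range_iff_exists_fun ℤ).1 this

open Classical in
/-- The rays that do not belong to a cone. -/
def offCone (s : Finset (Fin 3 → ℤ)) : Finset Y.rays :=
  Finset.univ.filter fun ρ : Y.rays => (ρ : Fin 3 → ℤ) ∉ s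

variable {Y} in
theorem mem_offCone {s : Finset (Fin 3 → ℤ)} {ρ : Y.rays} :
    ρ ∈ Y.offCone s ↔ (ρ : Fin 3 → ℤ) ∉ s := by
  simp [offCone]

section Chart

variable {Y} {s : Finset (Fin 3 → ℤ)} (B : Basis (Fin 3) ℤ (Fin 3 → ℤ))

/-- The monomial in the homogeneous coordinates that is the character dual to a basis vector. -/
def character (j : Fin 3) (x : Y.CoxSpace) : ℂ := ∏ ρ : Y.rays, x.1 ρ ^ B.coord j ρ

/-- The characters dual to a basis of the lattice, as functions on the toric variety. -/
def chartCoord : Y.Space → Fin 3 → ℂ :=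
  Quotient.lift (fun x j => character B j x) fun x y ⟨g, hg, h⟩ => by
    funext j
    have h1 : ∏ ρ : Y.rays, (g ρ : ℂ) ^ B.coord j ρ = 1 := by
      have := congrArg (fun u : ℂˣ => (u : ℂ)) (hg (B.coord j))
      simpa only [Units.coe_prod, Units.val_zpow_eq_zpow_val, Units.val_one] using this
    simp only [character, h, mul_zpow, Finset.prod_mul_distrib, h1, one_mul]

theorem coord_self (i j : Fin 3) : B.coord j (B i) = if i = j then 1 else 0 := by
  rw [Basis.coord_apply, Basis.repr_self, Finsupp.single_apply]

/-- A vanishing coordinate belongs to a basis vector other than `B j`, where the exponent is 0 and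
the power is 1. -/
theorem zpow_coord_ne_zero (hs : (s : Set (Fin 3 → ℤ)) ⊆ Set.range B) {x : Y.CoxSpace}
    (hx : ∀ ρ : Y.rays, x.1 ρ = 0 → (ρ : Fin 3 → ℤ) ∈ s) {j : Fin 3} (hj : B j ∉ s)
    (ρ : Y.rays) : x.1 ρ ^ B.coord j ρ ≠ 0 := by
  by_cases h : x.1 ρ = 0
  · obtain ⟨i, hi⟩ := hs (hx ρ h)
    have hij : i ≠ j := by
      rintro rfl
      exact hj (hi ▸ hx ρ h)
    rw [← hi, coord_self, if_neg hij, zpow_zero]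
    exact one_ne_zero
  · exact zpow_ne_zero _ h

theorem chartCoord_mem (hs : (s : Set (Fin 3 → ℤ)) ⊆ Set.range B) {p : Y.Space}
    (hp : p ∈ Y.chart s) : chartCoord B p ∈ partialTorus {j | B j ∉ s} := by
  induction p using Quotient.inductionOn with
  | h x =>
    intro j hj
    exact Finset.prod_ne_zero_iff.2 fun ρ _ => zpow_coord_ne_zero B hs (Y.proj_mem_chart.1 hp) hj ρ

theorem coord_nonneg_of_mem (hs : (s : Set (Fin 3 → ℤ)) ⊆ Set.range B) {u : Fin 3 → ℤ} (hu : u ∈ s)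
    (j : Fin 3) : 0 ≤ B.coord j u := by
  obtain ⟨i, rfl⟩ := hs hu
  rw [coord_self]
  split_ifs <;> simp

/-- A negative exponent can only sit on a ray outside `s`, and its homogeneous coordinate does not
vanish on the chart. -/
theorem continuous_chartCoord (hs : (s : Set (Fin 3 → ℤ)) ⊆ Set.range B) :
    Continuous fun p : Y.chart s => chartCoord B (p : Y.Space) := by
  rw [(Y.isQuotientMap_proj.restrictPreimage_isOpen (Y.isOpen_chart s)).continuous_iff]
  refine continuous_pi fun j => continuous_finsetProd _ fun ρ _ => ?_
  refine Continuous.zpow₀ ((Y.continuous_coord ρ).comp continuous_subtype_val) _ fun x => ?_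
  by_cases h : (ρ : Fin 3 → ℤ) ∈ s
  · exact Or.inr (coord_nonneg_of_mem B hs h j)
  · exact Or.inl fun h0 => h (Y.proj_mem_chart.1 x.2 ρ h0)

-- Among the rays of the cone only `B j` has a nonzero j-th coordinate.
open Classical in
theorem prod_zpow_coord {M : Type*} [DivisionCommMonoid M]
    (hs : (s : Set (Fin 3 → ℤ)) ⊆ Set.range B) (hsY : s ∈ Y.cones) (f : Y.rays → M) (j : Fin 3) :
    ∏ ρ : Y.rays, f ρ ^ B.coord j ρ
      = (if h : B j ∈ s then f ⟨B j, Finset.mem_biUnion.2 ⟨s, hsY, h⟩⟩ else 1)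
        * ∏ ρ ∈ Y.offCone s, f ρ ^ B.coord j ρ := by
  rw [← Finset.prod_filter_mul_prod_filter_not Finset.univ
    fun ρ : Y.rays => (ρ : Fin 3 → ℤ) ∈ s, offCone]
  congr 1
  have hne : ∀ ρ : Y.rays, (ρ : Fin 3 → ℤ) ∈ s → (ρ : Fin 3 → ℤ) ≠ B j →
      f ρ ^ B.coord j ρ = 1 := by
    intro ρ hρ hne
    obtain ⟨i, hi⟩ := hs hρ
    have hij : i ≠ j := by rintro rfl; exact hne hi.symm
    rw [← hi, coord_self, if_neg hij, zpow_zero]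
  by_cases h : B j ∈ s
  · rw [dif_pos h, Finset.prod_eq_single ⟨B j, Finset.mem_biUnion.2 ⟨s, hsY, h⟩⟩]
    · rw [coord_self, if_pos rfl, zpow_one]
    · intro ρ hρ hρ'
      exact hne ρ (Finset.mem_filter.1 hρ).2 fun h' => hρ' (Subtype.ext h')
    · intro h'
      simp [h] at h'
  · rw [dif_neg h]
    refine Finset.prod_eq_one fun ρ hρ => ?_
    have hρ' := (Finset.mem_filter.1 hρ).2
    exact hne ρ hρ' fun h' => h (h' ▸ hρ')

theorem mem_coxGroup_of_basis {g : Y.rays → ℂˣ}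
    (h : ∀ j, ∏ ρ : Y.rays, g ρ ^ B.coord j ρ = 1) : g ∈ Y.coxGroup := by
  intro m
  have hm : ∀ u : Fin 3 → ℤ, m u = ∑ j, B.coord j u * m (B j) := fun u => by
    conv_lhs => rw [← B.sum_repr u, map_sum]
    simp only [map_smul, smul_eq_mul, Basis.coord_apply]
  have : ∀ ρ : Y.rays, g ρ ^ m ρ = ∏ j, (g ρ ^ B.coord j ρ) ^ m (B j) := fun ρ => by
    simp only [hm ρ, ← zpow_mul]
    exact (prod_zpow_eq_zpow_sum _ _ _).symm
  simp only [this]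
  rw [Finset.prod_comm]
  refine Finset.prod_eq_one fun j _ => ?_
  rw [Finset.prod_zpow, h, one_zpow]

theorem chartCoord_injOn (hs : (s : Set (Fin 3 → ℤ)) ⊆ Set.range B) (hsY : s ∈ Y.cones) :
    Set.InjOn (chartCoord B) (Y.chart s) := by
  classical
  intro p hp q hq hpq
  induction p using Quotient.inductionOn with
  | h x =>
  induction q using Quotient.inductionOn with
  | h y =>
  replace hp := Y.proj_mem_chart.1 hp
  replace hq := Y.proj_mem_chart.1 hq
  have hxy : ∀ j, character B j x = character B j y := fun j => congrFun hpq j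
  -- Off the cone the group element is forced to be y/x. On the ray `B j` it is chosen to solve the
  -- j-th group equation, and equality of the j-th characters shows that it carries x to y there. If
  -- `B j` is not in the cone, that equality is the group equation itself.
  let g₀ : Y.rays → ℂˣ := fun ρ => if h : (ρ : Fin 3 → ℤ) ∈ s then 1 else
    Units.mk0 (y.1 ρ / x.1 ρ) (div_ne_zero (fun h0 => h (hq ρ h0)) fun h0 => h (hp ρ h0))
  let P : Fin 3 → ℂˣ := fun j => ∏ ρ ∈ Y.offCone s, g₀ ρ ^ B.coord j ρ
  let g : Y.rays → ℂˣ := fun ρ => if h : (ρ : Fin 3 → ℤ) ∈ s then (P (hs h).choose)⁻¹ else g₀ ρ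
  have hg₀ : ∀ ρ : Y.rays, (ρ : Fin 3 → ℤ) ∉ s → (g₀ ρ : ℂ) = y.1 ρ / x.1 ρ := fun ρ h => by
    simp [g₀, h]
  have hgB : ∀ (j : Fin 3) (h : B j ∈ s),
      g ⟨B j, Finset.mem_biUnion.2 ⟨s, hsY, h⟩⟩ = (P j)⁻¹ := fun j h => by
    have h2 : (hs h).choose = j := B.injective (hs h).choose_spec
    simp only [g]
    rw [dif_pos h, h2]
  have hgP : ∀ j, ∏ ρ ∈ Y.offCone s, g ρ ^ B.coord j ρ = P j := fun j => by
    refine Finset.prod_congr rfl fun ρ hρ => ?_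
    simp only [g, dif_neg (mem_offCone.1 hρ)]
  have hx0 : ∀ j, ∏ ρ ∈ Y.offCone s, x.1 ρ ^ B.coord j ρ ≠ 0 := fun j =>
    Finset.prod_ne_zero_iff.2 fun ρ hρ => zpow_ne_zero _ fun h0 =>
      mem_offCone.1 hρ (hp ρ h0)
  have hy0 : ∀ j, ∏ ρ ∈ Y.offCone s, y.1 ρ ^ B.coord j ρ ≠ 0 := fun j =>
    Finset.prod_ne_zero_iff.2 fun ρ hρ => zpow_ne_zero _ fun h0 =>
      mem_offCone.1 hρ (hq ρ h0)
  have hP : ∀ j, (P j : ℂ) = (∏ ρ ∈ Y.offCone s, y.1 ρ ^ B.coord j ρ)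
      / ∏ ρ ∈ Y.offCone s, x.1 ρ ^ B.coord j ρ := fun j => by
    simp only [P, Units.coe_prod, Units.val_zpow_eq_zpow_val]
    rw [← Finset.prod_div_distrib]
    refine Finset.prod_congr rfl fun ρ hρ => ?_
    rw [hg₀ ρ (mem_offCone.1 hρ), div_zpow]
  refine Quotient.sound ⟨g, mem_coxGroup_of_basis B fun j => ?_, fun ρ => ?_⟩
  · rw [prod_zpow_coord B hs hsY, hgP]
    by_cases h : B j ∈ s
    · rw [dif_pos h, hgB j h, inv_mul_cancel]
    · rw [dif_neg h, one_mul]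
      have := hxy j
      rw [character, character, prod_zpow_coord B hs hsY, prod_zpow_coord B hs hsY, dif_neg h,
        dif_neg h, one_mul, one_mul] at this
      rw [← Units.val_inj, hP, ← this, div_self (hx0 j), Units.val_one]
  · by_cases h : (ρ : Fin 3 → ℤ) ∈ s
    · obtain ⟨j, hj⟩ := hs h
      have hBj : B j ∈ s := hj ▸ h
      obtain rfl : ρ = ⟨B j, Finset.mem_biUnion.2 ⟨s, hsY, hBj⟩⟩ := Subtype.ext hj.symm
      have := hxy j
      rw [character, character, prod_zpow_coord B hs hsY, prod_zpow_coord B hs hsY, dif_pos hBj,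
        dif_pos hBj] at this
      rw [hgB j hBj, Units.val_inv_eq_inv_val, hP, inv_div]
      rw [div_mul_eq_mul_div, eq_div_iff (hy0 j), mul_comm (∏ ρ ∈ Y.offCone s, _)]
      exact this.symm
    · have hx : x.1 ρ ≠ 0 := fun h0 => h (hp ρ h0)
      simp only [g, dif_neg h]
      rw [hg₀ ρ h, div_mul_cancel₀ _ hx]

end Chart

end ToricCY3
end

/-! ### Inverses of the charts and the count of fixed points. -/

noncomputable section

namespace ToricCY3

variable {Y : ToricCY3} {s : Finset (Fin 3 → ℤ)} (B : Basis (Fin 3) ℤ (Fin 3 → ℤ))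

/-- Exponents that lift a point of the chart to homogeneous coordinates. -/
def IsLift (Y : ToricCY3) (s : Finset (Fin 3 → ℤ)) (B : Basis (Fin 3) ℤ (Fin 3 → ℤ))
    (k : Fin 3 → Y.rays → ℤ) : Prop :=
  (∀ i, ∑ ρ : Y.rays, k i ρ • (ρ : Fin 3 → ℤ) = B i) ∧
    ∀ i, B i ∈ s → ∀ ρ : Y.rays, ((ρ : Fin 3 → ℤ) = B i → k i ρ = 1) ∧
      ((ρ : Fin 3 → ℤ) ≠ B i → k i ρ = 0)

theorem exists_isLift (hsY : s ∈ Y.cones) : ∃ k, IsLift Y s B k := by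
  classical
  choose l hl using fun i => Y.exists_sum_smul_rays (B i)
  refine ⟨fun i ρ => if B i ∈ s then (if (ρ : Fin 3 → ℤ) = B i then 1 else 0) else l i ρ,
    fun i => ?_, fun i hi ρ => ⟨fun h => by simp [hi, h], fun h => by simp [hi, h]⟩⟩
  by_cases hi : B i ∈ s
  · simp only [if_pos hi]
    rw [Finset.sum_eq_single ⟨B i, Finset.mem_biUnion.2 ⟨s, hsY, hi⟩⟩]
    · simp
    · intro ρ _ hρ
      rw [if_neg fun h => hρ (Subtype.ext h), zero_smul]
    · simp
  · simp only [if_neg hi, hl]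

variable {B} {k : Fin 3 → Y.rays → ℤ}

theorem IsLift.mem_of_prod_eq_zero (hk : IsLift Y s B k) {c : Fin 3 → ℂ}
    (hc : c ∈ partialTorus {j | B j ∉ s}) {ρ : Y.rays} (h : ∏ i, c i ^ k i ρ = 0) :
    (ρ : Fin 3 → ℤ) ∈ s := by
  obtain ⟨i, -, hi⟩ := Finset.prod_eq_zero_iff.1 h
  have h0 := eq_zero_of_zpow_eq_zero hi
  have his : B i ∈ s := by
    by_contra his
    exact hc i his h0
  by_contra hρ
  rw [(hk.2 i his ρ).2 fun h => hρ (h ▸ his), zpow_zero] at hi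
  exact one_ne_zero hi

/-- The point of the Cox space with given coordinates in the chart. -/
def IsLift.point (hk : IsLift Y s B k) (hsY : s ∈ Y.cones) (c : partialTorus {j | B j ∉ s}) :
    Y.CoxSpace :=
  ⟨fun ρ => ∏ i, c.1 i ^ k i ρ, s, hsY, fun _ h => hk.mem_of_prod_eq_zero c.2 h⟩

theorem IsLift.continuous_point (hk : IsLift Y s B k) (hsY : s ∈ Y.cones) :
    Continuous (hk.point hsY) := by
  refine Continuous.subtype_mk (continuous_pi fun ρ => continuous_finsetProd _ fun i _ => ?_) _
  refine Continuous.zpow₀ ((continuous_apply i).comp continuous_subtype_val) _ fun c => ?_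
  by_cases h : B i ∈ s
  · by_cases hρ : (ρ : Fin 3 → ℤ) = B i
    · exact Or.inr (by rw [(hk.2 i h ρ).1 hρ]; exact zero_le_one)
    · exact Or.inr (by rw [(hk.2 i h ρ).2 hρ])
  · exact Or.inl (c.2 i h)

theorem IsLift.prod_zpow (hk : IsLift Y s B k) (hsY : s ∈ Y.cones) {c : Fin 3 → ℂ}
    (hc : c ∈ partialTorus {j | B j ∉ s}) (i j : Fin 3) :
    ∏ ρ : Y.rays, (c i ^ k i ρ) ^ B.coord j ρ = if i = j then c i else 1 := by
  have hfinal : (if i = j then c i else 1) = c i ^ B.coord j (B i) := by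
    rw [coord_self]
    split_ifs <;> simp
  rw [hfinal]
  -- If `B i` lies in the cone, `c i` may be 0 and exponents cannot be added, but only one factor is
  -- nontrivial. Otherwise `c i` is a unit and the exponents sum to the j-th coordinate of `B i`.
  by_cases h : B i ∈ s
  · rw [Finset.prod_eq_single ⟨B i, Finset.mem_biUnion.2 ⟨s, hsY, h⟩⟩]
    · rw [(hk.2 i h _).1 rfl, zpow_one]
    · intro ρ _ hρ
      rw [(hk.2 i h ρ).2 fun h => hρ (Subtype.ext h), zpow_zero, one_zpow]
    · simp
  · have hci : c i ≠ 0 := hc i h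
    have hu := prod_zpow_eq_zpow_sum Finset.univ (Units.mk0 (c i) hci)
      (fun ρ : Y.rays => k i ρ * B.coord j ρ)
    have hsum : ∑ ρ : Y.rays, k i ρ * B.coord j ρ = B.coord j (B i) := by
      conv_rhs => rw [← hk.1 i, map_sum]
      simp only [map_smul, smul_eq_mul]
    have := congrArg (fun u : ℂˣ => (u : ℂ)) hu
    rw [hsum] at this
    simpa only [Units.coe_prod, Units.val_zpow_eq_zpow_val, Units.val_mk0, zpow_mul] using this

theorem IsLift.chartCoord_point (hk : IsLift Y s B k) (hsY : s ∈ Y.cones)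
    (c : partialTorus {j | B j ∉ s}) : chartCoord B (Y.proj (hk.point hsY c)) = c.1 := by
  funext j
  change ∏ ρ : Y.rays, (∏ i, c.1 i ^ k i ρ) ^ B.coord j ρ = c.1 j
  simp only [← Finset.prod_zpow]
  rw [Finset.prod_comm]
  simp only [hk.prod_zpow hsY c.2]
  simp

/-- The chart of a cone is a product of lines and punctured lines. -/
def IsLift.chartHomeomorph (hk : IsLift Y s B k) (hs : (s : Set (Fin 3 → ℤ)) ⊆ Set.range B)
    (hsY : s ∈ Y.cones) : Y.chart s ≃ₜ partialTorus {j | B j ∉ s} where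
  toFun := fun p : Y.chart s => ⟨chartCoord B (p : Y.Space), chartCoord_mem B hs p.2⟩
  invFun c := ⟨Y.proj (hk.point hsY c),
    Y.proj_mem_chart.2 fun _ h => hk.mem_of_prod_eq_zero c.2 h⟩
  left_inv := fun p : Y.chart s => Subtype.ext (chartCoord_injOn B hs hsY
    (Y.proj_mem_chart.2 fun _ h => hk.mem_of_prod_eq_zero (chartCoord_mem B hs p.2) h) p.2
    (hk.chartCoord_point hsY _))
  right_inv c := Subtype.ext (hk.chartCoord_point hsY c)
  continuous_toFun := (continuous_chartCoord B hs).subtype_mk fun p => chartCoord_mem B hs p.2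
  continuous_invFun :=
    (Y.isQuotientMap_proj.continuous.comp (hk.continuous_point hsY)).subtype_mk _

theorem card_eq_three_iff (hs : (s : Set (Fin 3 → ℤ)) ⊆ Set.range B) :
    s.card = 3 ↔ {j | B j ∉ s} = ∅ := by
  classical
  have hmap : s ⊆ Finset.univ.image B := fun u hu => by
    obtain ⟨i, hi⟩ := hs hu
    exact Finset.mem_image.2 ⟨i, Finset.mem_univ _, hi⟩
  have hcard : (Finset.univ.image B).card = 3 := by
    rw [Finset.card_image_of_injective _ B.injective]; rfl
  rw [Set.eq_empty_iff_forall_notMem]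
  simp only [Set.mem_ofPred_eq, not_not]
  constructor
  · intro h j
    rw [Finset.eq_of_subset_of_card_le hmap (by rw [hcard, h])]
    exact Finset.mem_image_of_mem _ (Finset.mem_univ _)
  · intro h
    refine (congrArg Finset.card ?_).trans hcard
    refine hmap.antisymm fun u hu => ?_
    obtain ⟨j, -, rfl⟩ := Finset.mem_image.1 hu
    exact h j

variable (Y)

open Classical in
theorem hasChi_chart (hsY : s ∈ Y.cones) : HasChi (Y.chart s) (if s.card = 3 then 1 else 0) := by
  obtain ⟨B, hs⟩ := Y.smooth s hsY
  obtain ⟨k, hk⟩ := exists_isLift (Y := Y) B hsY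
  have h := HasChi.partialTorus {j | B j ∉ s}
  simp only [← card_eq_three_iff hs] at h
  exact h.of_homeomorph (hk.chartHomeomorph hs hsY).symm

theorem card_le_three (hsY : s ∈ Y.cones) : s.card ≤ 3 := by
  classical
  obtain ⟨B, hs⟩ := Y.smooth s hsY
  have hmap : s ⊆ Finset.univ.image B := fun u hu => by
    obtain ⟨i, hi⟩ := hs hu
    exact Finset.mem_image.2 ⟨i, Finset.mem_univ _, hi⟩
  exact (Finset.card_le_card hmap).trans Finset.card_image_le

/-- The open toric subvariety of a subfan. -/
def openUnion (D : Finset (Finset (Fin 3 → ℤ))) : Set Y.Space := {p | Y.zeros p ∈ D}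

theorem openUnion_eq_iUnion {D : Finset (Finset (Fin 3 → ℤ))} (hD : ∀ s ∈ D, ∀ t, t ⊆ s → t ∈ D) :
    Y.openUnion D = ⋃ s ∈ D, Y.chart s := by
  ext p
  simp only [Set.mem_iUnion, exists_prop]
  exact ⟨fun h => ⟨_, h, Finset.Subset.refl _⟩, fun ⟨s, hs, h⟩ => hD s hs _ h⟩

theorem isOpen_openUnion {D : Finset (Finset (Fin 3 → ℤ))} (hD : ∀ s ∈ D, ∀ t, t ⊆ s → t ∈ D) :
    IsOpen (Y.openUnion D) := by
  rw [Y.openUnion_eq_iUnion hD]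
  exact isOpen_biUnion fun s _ => Y.isOpen_chart s

/-- The Euler characteristic of an open toric subvariety is the number of its fixed points. -/
theorem hasChi_openUnion (n : ℕ) : ∀ D : Finset (Finset (Fin 3 → ℤ)), D.card = n → D ⊆ Y.cones →
    (∀ s ∈ D, ∀ t, t ⊆ s → t ∈ D) →
    HasChi (Y.openUnion D) ((D.filter fun s => s.card = 3).card : ℤ) := by
  classical
  induction n using Nat.strong_induction_on with
  | _ n ih =>
  intro D hn hDY hD
  rcases D.eq_empty_or_nonempty with rfl | hne
  · have : IsEmpty (Y.openUnion ∅) := ⟨fun p => by simpa [openUnion] using p.2⟩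
    simpa using HasChi.of_isEmpty (X := Y.openUnion ∅)
  -- A cone with the most generators is not a proper face, so removing it leaves a subfan. Its chart
  -- meets the rest in the subfan of its proper faces, which is smaller too, so the induction
  -- hypothesis covers both.
  obtain ⟨s, hs, hmax⟩ := D.exists_max_image Finset.card hne
  have hE : ∀ u ∈ D.erase s, ∀ t, t ⊆ u → t ∈ D.erase s := fun u hu t htu => by
    have hu' := Finset.mem_erase.1 hu
    refine Finset.mem_erase.2 ⟨?_, hD u hu'.2 t htu⟩
    rintro rfl
    exact hu'.1 (Finset.eq_of_subset_of_card_le htu (hmax u hu'.2)).symm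
  have hF : ∀ u ∈ s.ssubsets, ∀ t, t ⊆ u → t ∈ s.ssubsets := fun u hu t htu =>
    Finset.mem_ssubsets.2 (lt_of_le_of_lt htu (Finset.mem_ssubsets.1 hu))
  have hFE : s.ssubsets ⊆ D.erase s := fun t ht => by
    have := Finset.mem_ssubsets.1 ht
    exact Finset.mem_erase.2 ⟨this.ne, hD s hs t this.1⟩
  have hcard : (D.erase s).card < n := hn ▸ Finset.card_erase_lt_of_mem hs
  have h1 := ih _ hcard (D.erase s) rfl ((Finset.erase_subset _ _).trans hDY) hE
  have h2 := ih _ ((Finset.card_le_card hFE).trans_lt hcard) s.ssubsets rfl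
    ((hFE.trans (Finset.erase_subset _ _)).trans hDY) hF
  have h3 := Y.hasChi_chart (hDY hs)
  have hinter : Y.openUnion (D.erase s) ∩ Y.chart s = Y.openUnion s.ssubsets := by
    ext p
    simp only [openUnion, chart, Set.mem_inter_iff, Set.mem_ofPred_eq, Finset.mem_ssubsets]
    constructor
    · rintro ⟨hp, hps⟩
      exact hps.lt_of_ne (Finset.mem_erase.1 hp).1
    · intro hp
      exact ⟨hFE (Finset.mem_ssubsets.2 hp), hp.1⟩
  have hunion : Y.openUnion (D.erase s) ∪ Y.chart s = Y.openUnion D := by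
    ext p
    simp only [openUnion, chart, Set.mem_union, Set.mem_ofPred_eq]
    constructor
    · rintro (hp | hp)
      · exact Finset.mem_of_mem_erase hp
      · exact hD s hs _ hp
    · intro hp
      by_cases h : Y.zeros p = s
      · exact Or.inr h.le
      · exact Or.inl (Finset.mem_erase.2 ⟨h, hp⟩)
  -- Proper faces have fewer than three generators, so the overlap has Euler characteristic 0.
  have hz : (s.ssubsets.filter fun t => t.card = 3) = ∅ := by
    refine Finset.filter_eq_empty_iff.2 fun t ht => ?_
    have := Finset.card_lt_card (Finset.mem_ssubsets.1 ht)
    have := Y.card_le_three (hDY hs)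
    omega
  rw [hz, Finset.card_empty, Nat.cast_zero] at h2
  rw [← hinter] at h2
  have h4 := HasChi.union (Y.isOpen_openUnion hE) (Y.isOpen_chart s) h1 h3 h2
  rw [hunion, sub_zero] at h4
  convert h4 using 1
  rw [Finset.filter_erase]
  by_cases h : s.card = 3
  · have hmem : s ∈ D.filter fun t => t.card = 3 := Finset.mem_filter.2 ⟨hs, h⟩
    rw [if_pos h, ← Finset.card_erase_add_one hmem]
    push_cast
    rfl
  · have hmem : s ∉ D.filter fun t => t.card = 3 := fun h' => h (Finset.mem_filter.1 h').2
    rw [if_neg h, Finset.erase_eq_of_notMem hmem, add_zero]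

theorem hasChi_space : HasChi Y.Space (Y.vertices.card : ℤ) := by
  have h := Y.hasChi_openUnion _ Y.cones rfl subset_rfl Y.face_mem
  have e : Y.openUnion Y.cones = Set.univ := Set.eq_univ_of_forall Y.zeros_mem_cones
  rw [e] at h
  exact h.of_homeomorph (Homeomorph.Set.univ Y.Space)

/-- The Euler characteristic of a toric variety is the number of its fixed points. -/
theorem eulerCharacteristic_eq : Y.eulerCharacteristic = Y.vertices.card :=
  Y.hasChi_space.homologyEulerChar_eq

end ToricCY3
end

noncomputable section

/-! ### The elliptic genus -/

namespace Theta

/-- By oddness the second denominator is minus the first, which turns the sum into the difference in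
the three-term identity. -/
theorem mul_prod_add_prod_eq {ι : Type*} [Fintype ι] (hι : Fintype.card ι = 3) (τ : UpperHalfPlane)
    (z : ℂ) (w : ι → ℂ) (hw : ∑ i, w i = 0) (h0 : ∀ i, theta1 τ (w i) ≠ 0) :
    theta1 τ z * (∏ i, theta1 τ (z + w i) / theta1 τ (w i)
      + ∏ i, theta1 τ (z + -w i) / theta1 τ (-w i)) = theta1 τ (2 * z) := by
  let e := (Fintype.equivFinOfCardEq hι).symm
  rw [← e.sum_comp, Fin.sum_univ_three] at hw
  rw [← e.prod_comp, ← e.prod_comp, Fin.prod_univ_three, Fin.prod_univ_three]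
  have key := theta1_three_term τ z _ _ _ hw
  have h1 := h0 (e 0)
  have h2 := h0 (e 1)
  have h3 := h0 (e 2)
  simp only [theta1_neg, ← sub_eq_add_neg]
  generalize theta1 τ (2 * z) = T at key ⊢
  field_simp
  linear_combination key

/-- Zeros of an entire function that is not identically zero are isolated. -/
theorem eventually_theta1_ne_zero {τ : UpperHalfPlane} {w : ℂ} (hw : theta1 τ w ≠ 0) (z : ℂ) :
    ∀ᶠ ζ in nhdsWithin z {z}ᶜ, theta1 τ ζ ≠ 0 := by
  have ha : AnalyticOnNhd ℂ (theta1 τ) Set.univ := fun x _ => (differentiable_theta1 τ).analyticAt x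
  rcases (ha z trivial).eventually_eq_zero_or_eventually_ne_zero with h | h
  · have := ha.eqOn_zero_of_preconnected_of_eventuallyEq_zero isPreconnected_univ trivial h
    exact absurd (this (Set.mem_univ w)) hw
  · exact h

end Theta

namespace ToricCY3

variable {Y : ToricCY3} {e : Basis (Fin 2) ℤ (LinearMap.ker Y.height)}

theorem card_vertex (v : Y.vertices) : Fintype.card (v : Finset (Fin 3 → ℤ)) = 3 := by
  rw [Fintype.card_coe]
  exact (Finset.mem_filter.1 v.2).2

/-- The Calabi–Yau condition in coordinates: both linear forms take the value 1 on each generator.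
It forces the weights at a vertex to sum to zero. -/
theorem sum_coord_eq_height (v : Y.vertices) (n : Fin 3 → ℤ) :
    ∑ u : (v : Finset (Fin 3 → ℤ)), (Y.vertexBasis v).coord u n = Y.height n := by
  conv_rhs => rw [← (Y.vertexBasis v).sum_repr n, map_sum]
  refine Finset.sum_congr rfl fun u _ => ?_
  have hu : Y.height (Y.vertexBasis v u) = 1 := by
    rw [vertexBasis, Basis.mk_apply]
    exact Y.height_eq_one v (Finset.mem_filter.1 v.2).1 u u.2
  rw [map_smul, hu, smul_eq_mul, mul_one, Basis.coord_apply]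

theorem sum_weight (v : Y.vertices) (t₁ t₂ : ℂ) :
    ∑ u : (v : Finset (Fin 3 → ℤ)), Y.weight e v u t₁ t₂ = 0 := by
  simp only [weight, Finset.sum_add_distrib, ← Finset.sum_mul, ← Int.cast_sum, sum_coord_eq_height,
    LinearMap.mem_ker.1 (e 0).2, LinearMap.mem_ker.1 (e 1).2]
  simp

theorem weight_neg (v : Y.vertices) (u : (v : Finset (Fin 3 → ℤ))) (t₁ t₂ : ℂ) :
    Y.weight e v u (-t₁) (-t₂) = -Y.weight e v u t₁ t₂ := by
  rw [weight, weight]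
  ring

/-- Each vertex contributes θ₁(2z)/2. Keeping the factor θ₁(z) on the left makes the identity valid
at the zeros of θ₁ as well. -/
theorem theta1_mul_averagedEllipticGenus {τ : UpperHalfPlane} {t₁ t₂ : ℂ}
    (h : Y.IsRegular e τ t₁ t₂) (z : ℂ) :
    theta1 τ z * Y.averagedEllipticGenus e τ z t₁ t₂
      = (Y.eulerCharacteristic : ℂ) / 2 * theta1 τ (2 * z) := by
  rw [averagedEllipticGenus, ellipticGenus, ellipticGenus, ← Finset.sum_add_distrib]
  have hv : ∀ v : Y.vertices, theta1 τ z * (∏ u : (v : Finset (Fin 3 → ℤ)),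
      theta1 τ (z + Y.weight e v u t₁ t₂) / theta1 τ (Y.weight e v u t₁ t₂)
      + ∏ u : (v : Finset (Fin 3 → ℤ)), theta1 τ (z + Y.weight e v u (-t₁) (-t₂))
        / theta1 τ (Y.weight e v u (-t₁) (-t₂))) = theta1 τ (2 * z) := fun v => by
    simp only [weight_neg]
    exact Theta.mul_prod_add_prod_eq (card_vertex v) τ z _ (sum_weight v t₁ t₂) (h v)
  rw [mul_left_comm, Finset.mul_sum, Finset.sum_congr rfl fun v _ => hv v, Finset.sum_const,
    Finset.card_univ, Fintype.card_coe, eulerCharacteristic_eq, nsmul_eq_mul, Int.cast_natCast]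
  ring

theorem continuous_averagedEllipticGenus (τ : UpperHalfPlane) (t₁ t₂ : ℂ) :
    Continuous fun z => Y.averagedEllipticGenus e τ z t₁ t₂ := by
  have hθ := (Theta.differentiable_theta1 τ).continuous
  have hZ : ∀ t₁ t₂ : ℂ, Continuous fun z => Y.ellipticGenus e τ z t₁ t₂ := fun t₁ t₂ =>
    continuous_finsetSum _ fun v _ => continuous_finsetProd _ fun u _ =>
      (hθ.comp (continuous_id.add continuous_const)).div_const _
  exact ((hZ t₁ t₂).add (hZ _ _)).const_mul _

theorem tendsto_averagedEllipticGenus {τ : UpperHalfPlane} {t₁ t₂ : ℂ}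
    (h : Y.IsRegular e τ t₁ t₂) (z : ℂ) :
    Filter.Tendsto
      (fun ζ : ℂ => (Y.eulerCharacteristic : ℂ) / 2 * (theta1 τ (2 * ζ) / theta1 τ ζ))
      (nhdsWithin z {z}ᶜ) (nhds (Y.averagedEllipticGenus e τ z t₁ t₂)) := by
  -- Regularity at any weight of any vertex shows that θ₁ is not identically zero.
  obtain ⟨w, hw⟩ : ∃ w, theta1 τ w ≠ 0 := by
    obtain ⟨s, hs, hc⟩ := Y.exists_maximal
    obtain ⟨u, hu⟩ : s.Nonempty := Finset.card_pos.1 (by omega)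
    exact ⟨_, h ⟨s, Finset.mem_filter.2 ⟨hs, hc⟩⟩ ⟨u, hu⟩⟩
  refine (((continuous_averagedEllipticGenus τ t₁ t₂).tendsto z).mono_left
    nhdsWithin_le_nhds).congr' ?_
  filter_upwards [Theta.eventually_theta1_ne_zero hw z] with ζ hζ
  rw [← mul_div_assoc, ← theta1_mul_averagedEllipticGenus h ζ, mul_div_cancel_left₀ _ hζ]

end ToricCY3

end

theorem mainTheorem2 (Y : ToricCY3) (e : Module.Basis (Fin 2) ℤ (LinearMap.ker Y.height))
    (τ : UpperHalfPlane) :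
    -- independence of the equivariant parameters, for every `z`
    (∀ z t₁ t₂ s₁ s₂ : ℂ, Y.IsRegular e τ t₁ t₂ → Y.IsRegular e τ s₁ s₂ →
      Y.averagedEllipticGenus e τ z t₁ t₂ = Y.averagedEllipticGenus e τ z s₁ s₂) ∧
    -- the formula, wherever its right-hand side is defined
    (∀ z t₁ t₂ : ℂ, Y.IsRegular e τ t₁ t₂ → theta1 τ z ≠ 0 →
      Y.averagedEllipticGenus e τ z t₁ t₂ =
        (Y.eulerCharacteristic : ℂ) / 2 * (theta1 τ (2 * z) / theta1 τ z)) ∧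
    -- at the zeros of the denominator the right-hand side has a removable singularity,
    -- and the formula holds for its continuous extension
    (∀ z t₁ t₂ : ℂ, Y.IsRegular e τ t₁ t₂ →
      Filter.Tendsto
        (fun ζ : ℂ => (Y.eulerCharacteristic : ℂ) / 2 * (theta1 τ (2 * ζ) / theta1 τ ζ))
        (nhdsWithin z {z}ᶜ) (nhds (Y.averagedEllipticGenus e τ z t₁ t₂))) := by
  refine ⟨fun z t₁ t₂ s₁ s₂ ht hs => ?_, fun z t₁ t₂ ht hz => ?_, fun z t₁ t₂ ht => ?_⟩
  -- Both values are the limit of one function that does not involve the parameters; this also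
  -- covers the zeros of θ₁.
  · exact tendsto_nhds_unique (ToricCY3.tendsto_averagedEllipticGenus ht z)
      (ToricCY3.tendsto_averagedEllipticGenus hs z)
  · rw [← mul_div_assoc, ← ToricCY3.theta1_mul_averagedEllipticGenus ht z,
      mul_div_cancel_left₀ _ hz]
  · exact ToricCY3.tendsto_averagedEllipticGenus ht z
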